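/- Let $n\ge 1$, let $\lambda=(\lambda_1\ge\dots\ge\lambda_n\ge 0)$ be a partition, let $m\ge n+\lambda_1$, and let $w\in S_n$. Products of permutations are composed as functions, $s_i$ is the transposition exchanging $i$ and $i+1$, and $w_0$ is the longest element, $w_0(i)=n+1-i$. **Lascoux polynomials.** On $\mathbb Z[\beta][z_1,\dots,z_n]$ let $$\varpi_i f(\mathbf z)=\frac{(z_i+\beta z_iz_{i+1})f(\mathbf z)-(z_{i+1}+\beta z_iz_{i+1})f(s_i\mathbf z)}{z_i-z_{i+1}},$$ where $f(s_i\mathbf z)$ is $f$ with $z_i$ and $z_{i+1}$ exchanged. For a reduced expression $w=s_{i_1}\cdots s_{i_\ell}$ put $\varpi_w=\varpi_{i_1}\cdots\varpi_{i_\ell}$ and $L_{w\lambda}(\mathbf z;\beta)=\varpi_w\mathbf z^\lambda$. **The model.** Take a grid of $n$ rows (numbered from the top) and $m$ columns (numbered from the left), and colors $c_1>c_2>\dots>c_n>0$. Edges are labeled by $0$ or a color. The boundary labels are: $0$ on the right and on the bottom; on the left, color $c_i$ in row $(ww_0)(i)$; on the top, color $c_i$ in column $\lambda_{n+1-i}+i$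 for $1\le i\le n$, and $0$ in all other columns. Writing a vertex configuration as (left, top, right, bottom), the admissible vertices and their Boltzmann weights in a row with parameter $z$ are - $\mathtt a_1$: $(0,0,0,0)$, weight $1$; - $\mathtt a_2$: $(0,0,d,d)$, weight $1+\beta z$, for any color $d$; - $\mathtt b_2$: $(d,0,d,0)$, weight $z$, for any color $d$; - $\mathtt c_1$: $(d,d,0,0)$, weight $1$, for any color $d$; - $\mathtt b_1^\circ$: $(d,d,d,d)$, weight $1$, for any color $d$; - $\mathtt b_1$: $(c_j,c_j,c_i,c_i)$, weight $1$, for colors $c_i>c_j$; - $\mathtt b_1^\dagger$: $(c_j,c_i,c_j,c_i)$, weight $1$, for colors $c_i>c_j$; - $\mathtt b_1'$: $(c_i,c_i,c_j,c_j)$, weight $1$, for colors $c_i>c_j$ that do not cross, i.e. such that $(i,j)$ is not an inversion of $ww_0$: $i<j$ and $(ww_0)(i)<(ww_0)(j)$. Let $\mathfrak S_{\lambda,w}$ be the set of labelings with these boundary labels all of whose vertices are admissible. The weight of a state is the product of the weights of all its vertices, with $z=z_r$ in row $r$, and $Z(\mathfrak S_{\lambda,w};\mathbf z;\beta)$ is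 the sum of the weights of all states. **Theorem.** $L_{w\lambda}(\mathbf z;\beta)=Z(\mathfrak S_{\lambda,w};\mathbf z;\beta)$; in particular $\varpi_w\mathbf z^\lambda$ does not depend on the choice of the reduced expression of $w$. -/

import Mathlib

open MvPolynomial

namespace LascouxModel

/-! ### Lascoux polynomials

Throughout, `n + 1` is the (positive) number of variables, indexed by `Fin (n + 1)`; the simple
transpositions are indexed by `Fin n`. Products of permutations are composed as functions. -/

/-- The polynomial ring `ℤ[β][z_1, …, z_{n+1}]`. -/
abbrev Poly (n : ℕ) : Type := MvPolynomial (Fin (n + 1)) (Polynomial ℤ)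

/-- The parameter `β`. -/
noncomputable def beta (n : ℕ) : Poly n := C Polynomial.X

/-- The simple transposition `s_i`, exchanging `i` and `i + 1`. -/
def simpleSwap {n : ℕ} (i : Fin n) : Equiv.Perm (Fin (n + 1)) :=
  Equiv.swap i.castSucc i.succ

/-- The numerator `(z_i + β z_i z_{i+1}) f(z) - (z_{i+1} + β z_i z_{i+1}) f(s_i z)`. -/
noncomputable def demazureLascouxNumerator {n : ℕ} (i : Fin n) (f : Poly n) : Poly n :=
  (X i.castSucc + beta n * X i.castSucc * X i.succ) * f -
    (X i.succ + beta n * X i.castSucc * X i.succ) * rename (simpleSwap i) f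

theorem dvd_sub_rename {n : ℕ} (i : Fin n) (f : Poly n) :
    (X i.castSucc - X i.succ : Poly n) ∣ f - rename (simpleSwap i) f := by
  induction f using MvPolynomial.induction_on with
  | C a => simp
  | add p q hp hq =>
    have h : p + q - rename (simpleSwap i) (p + q) =
        (p - rename (simpleSwap i) p) + (q - rename (simpleSwap i) q) := by
      rw [map_add]; ring
    rw [h]
    exact dvd_add hp hq
  | mul_X p j hp =>
    have hX : (X i.castSucc - X i.succ : Poly n) ∣ X j - X (simpleSwap i j) := by
      unfold simpleSwap
      rcases eq_or_ne j i.castSucc with rfl | h1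
      · rw [Equiv.swap_apply_left]
      · rcases eq_or_ne j i.succ with rfl | h2
        · rw [Equiv.swap_apply_right]
          exact ⟨-1, by ring⟩
        · rw [Equiv.swap_apply_of_ne_of_ne h1 h2, sub_self]
          exact dvd_zero _
    have h : p * X j - rename (simpleSwap i) (p * X j) =
        (p - rename (simpleSwap i) p) * X j +
          rename (simpleSwap i) p * (X j - X (simpleSwap i j)) := by
      rw [map_mul, rename_X]; ring
    rw [h]
    exact dvd_add (Dvd.dvd.mul_right hp _) (Dvd.dvd.mul_left hX _)

theorem dvd_demazureLascouxNumerator {n : ℕ} (i : Fin n) (f : Poly n) :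
    (X i.castSucc - X i.succ : Poly n) ∣ demazureLascouxNumerator i f := by
  have h : demazureLascouxNumerator i f = (X i.castSucc - X i.succ) * f +
      (X i.succ + beta n * X i.castSucc * X i.succ) * (f - rename (simpleSwap i) f) := by
    unfold demazureLascouxNumerator; ring
  rw [h]
  exact dvd_add (dvd_mul_right _ _) (Dvd.dvd.mul_left (dvd_sub_rename i f) _)

/-- The Demazure--Lascoux operator `ϖ_i`: the exact quotient of the numerator by `z_i - z_{i+1}`. -/
noncomputable def demazureLascoux {n : ℕ} (i : Fin n) (f : Poly n) : Poly n :=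
  (dvd_demazureLascouxNumerator i f).choose

theorem demazureLascoux_spec {n : ℕ} (i : Fin n) (f : Poly n) :
    (X i.castSucc - X i.succ) * demazureLascoux i f = demazureLascouxNumerator i f :=
  (dvd_demazureLascouxNumerator i f).choose_spec.symm

theorem X_sub_X_ne_zero {n : ℕ} (i : Fin n) : (X i.castSucc - X i.succ : Poly n) ≠ 0 := by
  rw [sub_ne_zero]
  intro h
  exact (Fin.castSucc_lt_succ (i := i)).ne (X_injective h)

/-- `ϖ_i f` is the only polynomial that satisfies its defining equation. -/
theorem demazureLascoux_unique {n : ℕ} (i : Fin n) (f g : Poly n)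
    (h : (X i.castSucc - X i.succ) * g = demazureLascouxNumerator i f) :
    g = demazureLascoux i f :=
  mul_left_cancel₀ (X_sub_X_ne_zero i) (h.trans (demazureLascoux_spec i f).symm)

/-- The product `s_{i_1} s_{i_2} ⋯ s_{i_l}` of a word `i_1 i_2 ⋯ i_l`. -/
def wordProd {n : ℕ} (l : List (Fin n)) : Equiv.Perm (Fin (n + 1)) :=
  (l.map simpleSwap).prod

/-- The word `l` is a reduced expression of `w`. -/
def IsReducedWord {n : ℕ} (w : Equiv.Perm (Fin (n + 1))) (l : List (Fin n)) : Prop :=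
  wordProd l = w ∧ ∀ l' : List (Fin n), wordProd l' = w → l.length ≤ l'.length

theorem exists_wordProd {n : ℕ} (w : Equiv.Perm (Fin (n + 1))) :
    ∃ l : List (Fin n), wordProd l = w := by
  have hw : w ∈ Submonoid.closure (Set.range fun i : Fin n => Equiv.swap i.castSucc i.succ) := by
    rw [Equiv.Perm.mclosure_swap_castSucc_succ]; trivial
  induction hw using Submonoid.closure_induction with
  | mem x hx =>
    obtain ⟨i, rfl⟩ := hx
    exact ⟨[i], by simp [wordProd, simpleSwap]⟩
  | one => exact ⟨[], rfl⟩
  | mul x y _ _ hx hy =>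
    obtain ⟨l, rfl⟩ := hx
    obtain ⟨l', rfl⟩ := hy
    exact ⟨l ++ l', by simp [wordProd]⟩

theorem exists_isReducedWord {n : ℕ} (w : Equiv.Perm (Fin (n + 1))) :
    ∃ l : List (Fin n), IsReducedWord w l := by
  classical
  have h : ∃ k, ∃ l : List (Fin n), wordProd l = w ∧ l.length = k := by
    obtain ⟨l, hl⟩ := exists_wordProd w
    exact ⟨l.length, l, hl, rfl⟩
  obtain ⟨l, hl, hk⟩ := Nat.find_spec h
  exact ⟨l, hl, fun l' hl' => hk ▸ Nat.find_min' h ⟨l', hl', rfl⟩⟩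

/-- The composite `ϖ_{i_1} ϖ_{i_2} ⋯ ϖ_{i_l}` (so that `ϖ_{i_l}` is applied first). -/
noncomputable def demazureLascouxWord {n : ℕ} (l : List (Fin n)) (f : Poly n) : Poly n :=
  l.foldr demazureLascoux f

/-- The operator `ϖ_w`, through some reduced expression of `w`. -/
noncomputable def demazureLascouxPerm {n : ℕ} (w : Equiv.Perm (Fin (n + 1))) (f : Poly n) :
    Poly n :=
  demazureLascouxWord (exists_isReducedWord w).choose f

/-- The monomial `z^α`. -/
noncomputable def zPow {n : ℕ} (a : Fin (n + 1) → ℕ) : Poly n := ∏ i, X i ^ a i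

/-- The Lascoux polynomial `L_{wλ}(z; β) = ϖ_w z^λ`. -/
noncomputable def lascoux {n : ℕ} (w : Equiv.Perm (Fin (n + 1))) (lam : Fin (n + 1) → ℕ) :
    Poly n :=
  demazureLascouxPerm w (zPow lam)

/-! ### The colored lattice model -/

/-- Edge labels: `none` is the label `0`, and `some i` is the color `c_i`. The colors are ordered by
`c_1 > c_2 > ⋯`, so `c_i > c_j` means `i < j`. -/
abbrev Label (n : ℕ) : Type := Option (Fin (n + 1))

/-- The permutation `w w_0`, where `w_0` is the longest element. -/
def wLong {n : ℕ} (w : Equiv.Perm (Fin (n + 1))) : Equiv.Perm (Fin (n + 1)) :=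
  w * Fin.revPerm

/-- `c_i > c_j` is a pair of colors that do not cross: `(i, j)` is not an inversion of `w w_0`. -/
def NonCrossing {n : ℕ} (w : Equiv.Perm (Fin (n + 1))) (i j : Fin (n + 1)) : Prop :=
  i < j ∧ wLong w i < wLong w j

instance {n : ℕ} (w : Equiv.Perm (Fin (n + 1))) (i j : Fin (n + 1)) :
    Decidable (NonCrossing w i j) := by
  unfold NonCrossing; infer_instance

/-- The types of admissible configurations around a vertex. -/
inductive VertexType : Type
  | a1 | a2 | b1 | bDagger | bCirc | b2 | c1 | bPrime

/-- The type of the vertex with the given labels on its left, top, right and bottom edge in the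
modified model for `w`; it is `none` if the configuration is not admissible. -/
def vertexType {n : ℕ} (w : Equiv.Perm (Fin (n + 1))) :
    (left top right bottom : Label n) → Option VertexType
  | none, none, none, none => some .a1
  | none, none, some d, some d' => if d = d' then some .a2 else none
  | some d, none, some d', none => if d = d' then some .b2 else none
  | some d, some d', none, none => if d = d' then some .c1 else none
  | some l, some t, some r, some b =>
    if l = t ∧ r = b ∧ r < l then some .b1
    else if l = r ∧ t = b ∧ t < l then some .bDagger
    else if l = t ∧ t = r ∧ r = b then some .bCirc
    else if l = t ∧ r = b ∧ NonCrossing w l r then some .bPrime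
    else none
  | _, _, _, _ => none

/-- The Boltzmann weight of a type of vertex in a row with parameter `z`. -/
noncomputable def VertexType.weight {n : ℕ} (z : Poly n) : VertexType → Poly n
  | .a1 => 1
  | .a2 => 1 + beta n * z
  | .b1 => 1
  | .bDagger => 1
  | .bCirc => 1
  | .b2 => z
  | .c1 => 1
  | .bPrime => 1

/-- A labeling of the edges of the grid with `n + 1` rows, numbered from the top, and `m` columns,
numbered from the left. The vertex in row `r` and column `c` has the left edge `S.hor r c.castSucc`,
the right edge `S.hor r c.succ`, the top edge `S.vert r.castSucc c` and the bottom edge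
`S.vert r.succ c`. -/
@[ext]
structure Labeling (n m : ℕ) : Type where
  /-- labels of the horizontal edges -/
  hor : Fin (n + 1) → Fin (m + 1) → Label n
  /-- labels of the vertical edges -/
  vert : Fin (n + 2) → Fin m → Label n

/-- A labeling is the same as a pair of functions. -/
def Labeling.equivProd (n m : ℕ) :
    Labeling n m ≃ (Fin (n + 1) → Fin (m + 1) → Label n) × (Fin (n + 2) → Fin m → Label n) where
  toFun S := (S.hor, S.vert)
  invFun p := ⟨p.1, p.2⟩
  left_inv _ := rfl
  right_inv _ := rfl

instance (n m : ℕ) : Fintype (Labeling n m) :=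
  Fintype.ofEquiv _ (Labeling.equivProd n m).symm

/-- The type of the vertex in row `r` and column `c` of a labeling. -/
def Labeling.vertexAt {n m : ℕ} (w : Equiv.Perm (Fin (n + 1))) (S : Labeling n m)
    (r : Fin (n + 1)) (c : Fin m) : Option VertexType :=
  vertexType w (S.hor r c.castSucc) (S.vert r.castSucc c) (S.hor r c.succ) (S.vert r.succ c)

/-- The admissible states of the modified model for `lam` and `w`. -/
structure IsState {n m : ℕ} (lam : Fin (n + 1) → ℕ) (w : Equiv.Perm (Fin (n + 1)))
    (S : Labeling n m) : Prop where
  /-- The color `c_i` enters on the left in row `(w w_0)(i)`. -/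
  left : ∀ i, S.hor (wLong w i) 0 = some i
  /-- The color `c_i` is at the top of the column of the `i`-th `1` in the 0-1-sequence of `lam`;
  with columns and parts counted from `0`, this is column `lam (n - i) + i`. -/
  top : ∀ (c : Fin m) (i : Fin (n + 1)), S.vert 0 c = some i ↔ (c : ℕ) = lam i.rev + i
  right : ∀ r, S.hor r (Fin.last m) = none
  bottom : ∀ c, S.vert (Fin.last (n + 1)) c = none
  admissible : ∀ r c, (S.vertexAt w r c).isSome

open Classical in
/-- The set `𝔖_{λ,w}` of admissible states on `m` columns. -/
noncomputable def states {n : ℕ} (m : ℕ) (lam : Fin (n + 1) → ℕ) (w : Equiv.Perm (Fin (n + 1))) :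
    Finset (Labeling n m) :=
  Finset.univ.filter (IsState lam w)

/-- The Boltzmann weight of a labeling, with `z = z_r` in row `r`; it is `0` if some vertex is not
admissible. -/
noncomputable def Labeling.weight {n m : ℕ} (w : Equiv.Perm (Fin (n + 1))) (S : Labeling n m) :
    Poly n :=
  ∏ r, ∏ c, ((S.vertexAt w r c).elim 0 fun t => t.weight (X r))

/-- The partition function `Z(𝔖_{λ,w}; z; β)` of the modified model with `m` columns. -/
noncomputable def partitionFunction {n : ℕ} (m : ℕ) (lam : Fin (n + 1) → ℕ)
    (w : Equiv.Perm (Fin (n + 1))) : Poly n :=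
  ∑ S ∈ states m lam w, S.weight w

end LascouxModel

/-!
The partition function is computed row by row from the top, and within a row from the right to the
left. At each moment the labels on the edges between the processed and the remaining vertices form
a word, and a vertex either keeps or exchanges two adjacent letters of it (`step`).

Rename every color as the number of the row in which its path begins, so that a path has to leave
row `k` with label `k`. A pair of colors that is not an inversion of `w w_0` can never cross: once
crossed, such colors stay so and leave in the wrong rows (`step_eq_zero_of_hasCrossed`). Hence, in
every state, each vertex with two colors sends the smaller row number to the left and the larger
one to the bottom (`colorPF_eq_sortPF`). In this *sorting model* the vertices no longer depend on
`w`; only the word on the top boundary does.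

It remains to compare the top words for `w` and `s_i w` when `s_i w` is longer than `w`. They differ
by exchanging the adjacent labels `x = i` and `y = i + 1`, of which `y` is on the left of `x` in the
word for `w`. The rows above row `i` do not distinguish `x` from `y` until they meet, and then
produce the same word in both cases, so that the relation between the two partition functions
(`ExchangeRel`) is inherited from the rows `i` and `i + 1` (`ExchangeRel.step`). For these two rows,
the sorted word has as many states as the unsorted one has with `x`, `y` leaving in either order
(`rowOp_relabel_of_unsorted`), and the two orders are related by exchanging `z_i` and `z_{i+1}`
through a Yang--Baxter equation (`yangBaxter`, `twoRowOp_exchange`). The result is exactly the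
defining equation of the operator `ϖ_i`.

For `w = 1` the only state has weight `z^λ` (`sortPF_topWord_rev`). Induction along an arbitrary
reduced word, whose first letters always increase the length by the exchange condition
(`exists_wordProd_eq_swap_mul`), identifies `ϖ_{i_1} ⋯ ϖ_{i_l} z^λ` with the partition function. As
the latter does not involve the word, independence of the reduced expression follows without the
braid relations.
-/

namespace LascouxModel

/-! ### Words and vertex operators -/

/-- The word `w` with the letters in positions `c` and `c + 1` exchanged. -/
def exch {α : Type*} (c : ℕ) (w : ℕ → α) : ℕ → α := fun p => w (Equiv.swap c (c + 1) p)

section exch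
variable {α : Type*} (c : ℕ) (w : ℕ → α)

@[simp] theorem exch_left : exch c w c = w (c + 1) := by simp [exch]

@[simp] theorem exch_right : exch c w (c + 1) = w c := by simp [exch]

theorem exch_of_ne {p : ℕ} (h : p ≠ c) (h' : p ≠ c + 1) : exch c w p = w p := by
  simp [exch, Equiv.swap_apply_of_ne_of_ne h h']

theorem exch_comm {c d : ℕ} (h : c + 2 ≤ d) : exch c (exch d w) = exch d (exch c w) := by
  have h0 : Equiv.swap c (c + 1) * Equiv.swap d (d + 1) =
      Equiv.swap d (d + 1) * Equiv.swap c (c + 1) :=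
    (Equiv.Perm.disjoint_swap_swap (by simp; omega)).commute
  funext p
  have := congrArg (fun e : Equiv.Perm ℕ => w (e p)) h0
  simpa [exch] using this.symm

/-- The word `w` with the letters in positions `c`, `c + 1`, `c + 2` replaced. -/
def put (x y z : α) : ℕ → α :=
  fun p => if p = c then x else if p = c + 1 then y else if p = c + 2 then z else w p

@[simp] theorem put_zero (x y z : α) : put c w x y z c = x := by simp [put]
@[simp] theorem put_one (x y z : α) : put c w x y z (c + 1) = y := by simp [put]
@[simp] theorem put_two (x y z : α) : put c w x y z (c + 1 + 1) = z := by simp [put, add_assoc]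

theorem put_self : put c w (w c) (w (c + 1)) (w (c + 2)) = w := by
  funext p; unfold put; split_ifs <;> simp_all

@[simp] theorem exch_put (x y z : α) : exch c (put c w x y z) = put c w y x z := by
  funext p
  by_cases h : p = c
  · subst h; simp
  by_cases h' : p = c + 1
  · subst h'; simp
  rw [exch_of_ne _ _ h h']; simp [put, h, h']

@[simp] theorem exch_succ_put (x y z : α) : exch (c + 1) (put c w x y z) = put c w x z y := by
  funext p
  by_cases h : p = c + 1
  · subst h; simp
  by_cases h' : p = c + 1 + 1
  · subst h'; simp
  rw [exch_of_ne _ _ h h']; simp [put, h, h']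

end exch

/-- The operator of the vertex in column `c` on functions of words. In the word `w` the letters
`w c` and `w (c + 1)` are the labels on the top and on the right of the vertex; either they stay
(top goes to left, right goes to bottom), with coefficient `a`, or they are exchanged, with
coefficient `b`. -/
def step {α R : Type*} [CommRing R] (a b : α → α → R) (c : ℕ) (f : (ℕ → α) → R) (w : ℕ → α) : R :=
  a (w c) (w (c + 1)) * f w + b (w c) (w (c + 1)) * f (exch c w)

/-- The operator of the first `m` columns of a row, processed from the right to the left. -/
def rowOp {α R : Type*} [CommRing R] (a b : α → α → R) :
    ℕ → ((ℕ → α) → R) → (ℕ → α) → R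
  | 0, f => f
  | m + 1, f => step a b m (rowOp a b m f)

/-- The end of a row: the label `x` leaves on the left. -/
def exit {α R : Type*} [DecidableEq α] [CommRing R] (x : α) (f : (ℕ → α) → R) (w : ℕ → α) : R :=
  if w 0 = x then f (fun p => w (p + 1)) else 0

open Classical in
/-- The partition function of `j` rows with `m` columns, the first of them row `k`, as a function
of the word on the top; `x k` is the label that leaves row `k` on the left, and `e` is the empty
label, found everywhere below the last row. -/
noncomputable def rowsPF {α R : Type*} [DecidableEq α] [CommRing R] (a b : ℕ → α → α → R)
    (x : ℕ → α) (e : α) (m : ℕ) : ℕ → ℕ → (ℕ → α) → R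
  | 0, _ => fun w => if ∀ p, w p = e then 1 else 0
  | j + 1, k => rowOp (a k) (b k) m (exit (x k) (rowsPF a b x e m j (k + 1)))

section general
variable {α R : Type*} [CommRing R]

/-- An induction principle for rows: a relation between functions of words that is preserved by
the operators of the columns is preserved by the operators of the row. -/
theorem rowOp_induction {α' : Type*} {a b : α → α → R} {a' b' : α' → α' → R} {m : ℕ}
    (P : ((ℕ → α) → R) → ((ℕ → α') → R) → Prop)
    (hP : ∀ c < m, ∀ f f', P f f' → P (step a b c f) (step a' b' c f'))
    {f : (ℕ → α) → R} {f' : (ℕ → α') → R} (hf : P f f') :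
    P (rowOp a b m f) (rowOp a' b' m f') := by
  induction m with
  | zero => exact hf
  | succ m ih => exact hP m (by omega) _ _ (ih fun c hc => hP c (by omega))

theorem exists_exch {c p : ℕ} (w : ℕ → α) {x : α} (h : w p = x) : ∃ p, exch c w p = x :=
  ⟨Equiv.swap c (c + 1) p, by simp [exch, h]⟩

/-- A label that still occurs although it leaves no later row makes the partition function
vanish. -/
theorem rowsPF_eq_zero [DecidableEq α] (a b : ℕ → α → α → R) (x : ℕ → α) {e : α} (m : ℕ) {y : α}
    (hy : y ≠ e) (j k : ℕ) (hx : ∀ k', k ≤ k' → k' < k + j → x k' ≠ y) (w : ℕ → α)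
    (hw : ∃ p, w p = y) :
    rowsPF a b x e m j k w = 0 := by
  classical
  induction j generalizing k w with
  | zero =>
    obtain ⟨p, rfl⟩ := hw
    simp only [rowsPF]
    rw [if_neg fun h => hy (h p)]
  | succ j ih =>
    refine (rowOp_induction (a' := a k) (b' := b k) (fun f _ => ∀ w, (∃ p, w p = y) → f w = 0)
      ?_ (f' := 0) ?_) w hw
    · intro c _ f _ hf w hw
      obtain ⟨p, hp⟩ := hw
      simp [step, hf w ⟨p, hp⟩, hf _ (exists_exch w hp)]
    · rintro w ⟨p, hp⟩
      unfold exit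
      split_ifs with h
      · refine ih (k + 1) (fun k' h1 h2 => hx k' (by omega) (by omega)) _ ?_
        cases p with
        | zero => exact absurd (h.symm.trans hp) (hx k le_rfl (by omega))
        | succ p => exact ⟨p, hp⟩
      · rfl

theorem step_comm (a b a' b' : α → α → R) {c d : ℕ} (h : c + 2 ≤ d) (f : (ℕ → α) → R) :
    step a b c (step a' b' d f) = step a' b' d (step a b c f) := by
  funext w
  have h1 := exch_of_ne c w (p := d) (by omega) (by omega)
  have h2 := exch_of_ne c w (p := d + 1) (by omega) (by omega)
  have h3 := exch_of_ne d w (p := c) (by omega) (by omega)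
  have h4 := exch_of_ne d w (p := c + 1) (by omega) (by omega)
  simp only [step, h1, h2, h3, h4, exch_comm w h]
  ring

/-- The operator of a row, shifted by one position: the row acts on a word whose first letter is
the label on the left of the row above it. -/
def rowOpSucc (a b : α → α → R) : ℕ → ((ℕ → α) → R) → (ℕ → α) → R
  | 0, f => f
  | m + 1, f => step a b (m + 1) (rowOpSucc a b m f)

theorem rowOp_step_comm (a b a' b' : α → α → R) (m d : ℕ) (h : m + 1 ≤ d) (f : (ℕ → α) → R) :
    rowOp a b m (step a' b' d f) = step a' b' d (rowOp a b m f) := by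
  induction m with
  | zero => rfl
  | succ m ih =>
    rw [rowOp, ih (by omega), step_comm _ _ _ _ (by omega)]; rfl

theorem exit_step [DecidableEq α] (a b : α → α → R) (x : α) (c : ℕ) (f : (ℕ → α) → R) :
    exit x (step a b c f) = step a b (c + 1) (exit x f) := by
  funext w
  have h0 : exch (c + 1) w 0 = w 0 := exch_of_ne _ _ (by omega) (by omega)
  have h1 : (fun p => exch (c + 1) w (p + 1)) = exch c fun p => w (p + 1) := by
    funext p
    by_cases h : p = c
    · subst h; simp
    by_cases h' : p = c + 1
    · subst h'; simp
    rw [exch_of_ne _ _ (by omega) (by omega), exch_of_ne _ _ h h']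
  simp only [exit, step, h0, h1]
  split_ifs <;> simp

theorem exit_rowOp [DecidableEq α] (a b : α → α → R) (x : α) (m : ℕ) (f : (ℕ → α) → R) :
    exit x (rowOp a b m f) = rowOpSucc a b m (exit x f) := by
  induction m with
  | zero => rfl
  | succ m ih => rw [rowOp, exit_step, ih]; rfl

theorem map_rowOp {S : Type*} [CommRing S] (s : R →+* S) (a b : α → α → R) (m : ℕ)
    (f : (ℕ → α) → R) (w : ℕ → α) :
    s (rowOp a b m f w) =
      rowOp (fun t r => s (a t r)) (fun t r => s (b t r)) m (fun w => s (f w)) w := by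
  induction m generalizing w with
  | zero => rfl
  | succ m ih => simp [rowOp, step, ih]

end general

/-! ### The sorting model and its Yang--Baxter equation -/

/-- Coefficient of a vertex of the sorting model that keeps the labels `t` (top) and `r` (right).
The label `⊤` is the empty one, and every other label is the number of the row where its path
begins. A vertex sends the smaller of its two labels to the left; only if this means moving a label
into an empty column, the label may also go to the bottom, with coefficient `1 + β z`. -/
def sortStay {R : Type*} [CommRing R] (β z : R) (t r : WithTop ℕ) : R :=
  if t ≤ r then 1 else if t = ⊤ then 1 + β * z else 0

/-- Coefficient of a vertex of the sorting model that exchanges the labels `t` (top) and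
`r` (right). -/
def sortCross {R : Type*} [CommRing R] (z : R) (t r : WithTop ℕ) : R :=
  if t ≤ r then 0 else if t = ⊤ then z else 1

section YangBaxter
variable {R : Type*} [CommRing R]

/-- Diagonal coefficients of the `R`-matrix of two rows with the parameters `A` and `B`. It is
normalized so that its coefficient on a sorted pair of labels is `B (1 + β A)`. -/
def rStay (β A B : R) (t r : WithTop ℕ) : R :=
  if t ≤ r then B * (1 + β * A) else if t = ⊤ then B * (1 + β * B) else A * (1 + β * B)

/-- Off-diagonal coefficients of the `R`-matrix. -/
def rCross (A B : R) (t r : WithTop ℕ) : R :=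
  if t ≤ r then 0 else if t = ⊤ then -((A - B) * B) else -(A - B)

theorem lt_eq_gt_cases (x y : ℕ) : (x ≤ y ∧ ¬y ≤ x) ∨ x = y ∨ (y ≤ x ∧ ¬x ≤ y) := by omega

/-- The Yang--Baxter equation: the `R`-matrix moves through one column of two consecutive rows and
exchanges their parameters. The lower row acts one position to the right of the upper one, since
the label on the left of the upper row is still part of the word. -/
theorem yangBaxter (β A B : R) (c : ℕ) (f : (ℕ → WithTop ℕ) → R) :
    step (sortStay β A) (sortCross A) c (step (sortStay β B) (sortCross B) (c + 1)
      (step (rStay β A B) (rCross A B) c f)) =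
    step (rStay β A B) (rCross A B) (c + 1) (step (sortStay β B) (sortCross B) c
      (step (sortStay β A) (sortCross A) (c + 1) f)) := by
  funext w
  rw [← put_self c w]
  generalize w c = x, w (c + 1) = y, w (c + 2) = z
  simp only [step, put_zero, put_one, put_two, exch_put, exch_succ_put]
  generalize put c w = g
  unfold sortStay sortCross rStay rCross
  induction x using WithTop.recTopCoe <;> induction y using WithTop.recTopCoe <;>
    induction z using WithTop.recTopCoe <;>
    simp only [le_top, top_le_iff, WithTop.coe_ne_top, if_true, if_false, WithTop.coe_le_coe,
      le_refl]
  case coe.coe.coe x y z =>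
    rcases lt_eq_gt_cases x y with ⟨_, _⟩ | h | ⟨_, _⟩ <;>
    rcases lt_eq_gt_cases y z with ⟨_, _⟩ | h' | ⟨_, _⟩ <;>
    rcases lt_eq_gt_cases x z with ⟨_, _⟩ | h'' | ⟨_, _⟩ <;>
    first
    | omega
    | (subst_vars; simp only [*, le_refl, if_true, if_false]; ring)
  case' coe.coe.top x y => have h := lt_eq_gt_cases x y
  case' coe.top.coe x y => have h := lt_eq_gt_cases x y
  case' top.coe.coe x y => have h := lt_eq_gt_cases x y
  case coe.coe.top | coe.top.coe | top.coe.coe =>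
    rcases h with ⟨_, _⟩ | rfl | ⟨_, _⟩ <;> simp only [*, le_refl, if_true, if_false] <;> ring
  all_goals ring

end YangBaxter

/-! ### Exchanging the parameters of two rows -/

section twoRows
variable {R : Type*} [CommRing R]

theorem rowOp_linear {α : Type*} (a b : α → α → R) (m : ℕ) (u v : R) (f g : (ℕ → α) → R) :
    rowOp a b m (fun w => u * f w + v * g w) =
      fun w => u * rowOp a b m f w + v * rowOp a b m g w := by
  induction m with
  | zero => rfl
  | succ m ih =>
    funext w
    simp only [rowOp, ih, step]
    ring

theorem rowOpSucc_linear {α : Type*} (a b : α → α → R) (m : ℕ) (u v : R) (f g : (ℕ → α) → R) :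
    rowOpSucc a b m (fun w => u * f w + v * g w) =
      fun w => u * rowOpSucc a b m f w + v * rowOpSucc a b m g w := by
  induction m with
  | zero => rfl
  | succ m ih =>
    funext w
    simp only [rowOpSucc, ih, step]
    ring

/-- The operator of two rows with the parameters `A` and `B`, up to the labels that leave them on
the left. -/
def twoRowOp (β A B : R) (m : ℕ) (f : (ℕ → WithTop ℕ) → R) : (ℕ → WithTop ℕ) → R :=
  rowOp (sortStay β A) (sortCross A) m (rowOpSucc (sortStay β B) (sortCross B) m f)

theorem twoRowOp_succ (β A B : R) (m : ℕ) (f : (ℕ → WithTop ℕ) → R) :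
    twoRowOp β A B (m + 1) f = step (sortStay β A) (sortCross A) m
      (step (sortStay β B) (sortCross B) (m + 1) (twoRowOp β A B m f)) := by
  rw [twoRowOp, twoRowOp, rowOpSucc, rowOp, rowOp_step_comm _ _ _ _ _ _ le_rfl]

/-- The `R`-matrix moves through two rows from the left to the right. -/
theorem twoRowOp_rMatrix (β A B : R) (m : ℕ) (f : (ℕ → WithTop ℕ) → R) :
    twoRowOp β A B m (step (rStay β A B) (rCross A B) 0 f) =
      step (rStay β A B) (rCross A B) m (twoRowOp β B A m f) := by
  induction m with
  | zero => rfl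
  | succ m ih => rw [twoRowOp_succ, ih, yangBaxter, ← twoRowOp_succ]

/-- On the left boundary, the `R`-matrix mixes the two orders in which `x` and `y` can leave. -/
theorem rMatrix_exit (β A B : R) {x y : WithTop ℕ} (hxy : x < y) (hy : y ≠ ⊤)
    (G : (ℕ → WithTop ℕ) → R) :
    step (rStay β A B) (rCross A B) 0 (exit x (exit y G)) = fun w =>
      (B * (1 + β * A)) * exit x (exit y G) w + -(A - B) * exit y (exit x G) w := by
  funext w
  have hs : (fun p => exch 0 w (p + 1 + 1)) = fun p => w (p + 1 + 1) := by
    funext p; exact exch_of_ne _ _ (by omega) (by omega)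
  have h0 : exch 0 w 0 = w 1 := exch_left 0 w
  have h1 : exch 0 w 1 = w 0 := exch_right 0 w
  simp only [step, exit, zero_add, h0, h1, hs]
  by_cases hx0 : w 0 = x
  · by_cases hy1 : w 1 = y
    · simp [hx0, hy1, hxy.ne, hxy.ne', rStay, hxy.le]
    · simp [hx0, hy1, hxy.ne]
  · by_cases hy0 : w 0 = y
    · by_cases hx1 : w 1 = x
      · simp [hy0, hx1, hxy.ne', rCross, hxy.not_ge, hy]
      · simp [hy0, hx1, hxy.ne']
    · simp [hx0, hy0]

/-- The partition functions of two rows that `x` and `y` leave in either order, and the effect of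
exchanging the parameters; on the right boundary, where both labels are `⊤`, the `R`-matrix is a
scalar. -/
theorem twoRowOp_exchange (β A B : R) (m : ℕ) {x y : WithTop ℕ} (hxy : x < y) (hy : y ≠ ⊤)
    (G : (ℕ → WithTop ℕ) → R) (w : ℕ → WithTop ℕ) (h0 : w m = ⊤) (h1 : w (m + 1) = ⊤) :
    B * (1 + β * A) * twoRowOp β A B m (exit x (exit y G)) w -
        (A - B) * twoRowOp β A B m (exit y (exit x G)) w =
      B * (1 + β * A) * twoRowOp β B A m (exit x (exit y G)) w := by
  have h := congrFun (twoRowOp_rMatrix β A B m (exit x (exit y G))) w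
  rw [rMatrix_exit β A B hxy hy, twoRowOp, rowOpSucc_linear, rowOp_linear] at h
  simp only [step, h0, h1, rStay, rCross, le_refl, if_true, zero_mul, add_zero] at h
  rw [← h]
  simp only [twoRowOp]
  ring

end twoRows

/-! ### Exchanging two adjacent labels -/

section relabel
variable {x y : WithTop ℕ}

theorem swap_le_swap_iff (hxy : x ⋖ y) {t r : WithTop ℕ} (h : ¬(t = y ∧ r = x))
    (h' : ¬(t = x ∧ r = y)) : Equiv.swap x y t ≤ Equiv.swap x y r ↔ t ≤ r := by
  have hlt := hxy.lt
  have key : ∀ z, z ≠ x → z ≠ y → z < x ∨ y < z := by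
    intro z hx hy
    rcases lt_or_gt_of_ne hx with h | h
    · exact Or.inl h
    · exact Or.inr (lt_of_le_of_ne (not_lt.1 (hxy.2 h)) hy.symm)
  have kt := key t
  have kr := key r
  rw [Equiv.swap_apply_def, Equiv.swap_apply_def]
  split_ifs <;> grind

theorem swap_eq_top_iff (hxy : x < y) (hy : y ≠ ⊤) (t : WithTop ℕ) :
    Equiv.swap x y t = ⊤ ↔ t = ⊤ := by
  have hx : x ≠ ⊤ := ne_top_of_lt hxy
  rw [Equiv.swap_apply_def]
  split_ifs <;> simp_all

/-- The labels `x` and `y` occur exactly once in the word `w`, and `y` is to the left of `x`. -/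
def Unsorted (x y : WithTop ℕ) (w : ℕ → WithTop ℕ) : Prop :=
  ∃ p q, p < q ∧ w p = y ∧ w q = x ∧ ∀ r, r ≠ p → r ≠ q → w r ≠ x ∧ w r ≠ y

/-- The word `w` with the labels `x` and `y` exchanged. -/
def relabel (x y : WithTop ℕ) (w : ℕ → WithTop ℕ) : ℕ → WithTop ℕ := fun p => Equiv.swap x y (w p)

theorem exch_relabel (c : ℕ) (w : ℕ → WithTop ℕ) :
    exch c (relabel x y w) = relabel x y (exch c w) := rfl

theorem Unsorted.exch_eq_relabel {w : ℕ → WithTop ℕ} (h : Unsorted x y w) (hxy : x ≠ y) {c : ℕ}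
    (hy : w c = y) (hx : w (c + 1) = x) : exch c w = relabel x y w := by
  obtain ⟨p, q, hpq, hp, hq, hr⟩ := h
  obtain rfl : c = p := by
    by_contra h1
    by_cases h2 : c = q
    · subst h2; exact hxy (hq.symm.trans hy)
    · exact (hr c h1 h2).2 hy
  obtain rfl : c + 1 = q := by
    by_contra h2
    exact (hr (c + 1) (by omega) h2).1 hx
  funext r
  by_cases h1 : r = c
  · subst h1; simp [relabel, hp, hq]
  by_cases h2 : r = c + 1
  · subst h2; simp [relabel, hp, hq]
  rw [exch_of_ne _ _ h1 h2, relabel, Equiv.swap_apply_of_ne_of_ne (hr r h1 h2).1 (hr r h1 h2).2]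

theorem swap_lt_swap {c p q : ℕ} (hpq : p < q) (h : ¬(p = c ∧ q = c + 1)) :
    Equiv.swap c (c + 1) p < Equiv.swap c (c + 1) q := by
  rw [Equiv.swap_apply_def, Equiv.swap_apply_def]
  split_ifs <;> omega

theorem Unsorted.exch {w : ℕ → WithTop ℕ} (h : Unsorted x y w) {c : ℕ}
    (hc : ¬(w c = y ∧ w (c + 1) = x)) : Unsorted x y (exch c w) := by
  obtain ⟨p, q, hpq, hp, hq, hr⟩ := h
  refine ⟨Equiv.swap c (c + 1) p, Equiv.swap c (c + 1) q, swap_lt_swap hpq ?_, ?_, ?_, ?_⟩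
  · rintro ⟨rfl, rfl⟩; exact hc ⟨hp, hq⟩
  · simp [LascouxModel.exch, hp]
  · simp [LascouxModel.exch, hq]
  · intro r h1 h2
    refine hr _ ?_ ?_
    · rintro rfl; simp at h1
    · rintro rfl; simp at h2

/-- In an unsorted word `y` is not directly to the right of `x`. -/
theorem Unsorted.not_adjacent {w : ℕ → WithTop ℕ} (h : Unsorted x y w) (hxy : x ≠ y) (c : ℕ) :
    ¬(w c = x ∧ w (c + 1) = y) := by
  obtain ⟨p, q, hpq, hp, hq, hr⟩ := h
  rintro ⟨h1, h2⟩
  have hq' : c = q := by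
    by_contra h3
    by_cases h4 : c = p
    · subst h4; exact hxy (h1.symm.trans hp)
    · exact (hr c h4 h3).1 h1
  have hp' : c + 1 = p := by
    by_contra h3
    exact (hr (c + 1) h3 (by omega)).2 h2
  omega

variable {R : Type*} [CommRing R]

theorem sortStay_swap (hxy : x ⋖ y) (hy : y ≠ ⊤) (β z : R) {t r : WithTop ℕ}
    (h : ¬(t = y ∧ r = x)) (h' : ¬(t = x ∧ r = y)) :
    sortStay β z (Equiv.swap x y t) (Equiv.swap x y r) = sortStay β z t r := by
  simp only [sortStay, swap_le_swap_iff hxy h h', swap_eq_top_iff hxy.lt hy]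

theorem sortCross_swap (hxy : x ⋖ y) (hy : y ≠ ⊤) (z : R) {t r : WithTop ℕ}
    (h : ¬(t = y ∧ r = x)) (h' : ¬(t = x ∧ r = y)) :
    sortCross z (Equiv.swap x y t) (Equiv.swap x y r) = sortCross z t r := by
  simp only [sortCross, swap_le_swap_iff hxy h h', swap_eq_top_iff hxy.lt hy]

theorem step_relabel (hxy : x ⋖ y) (hy : y ≠ ⊤) (β z : R) (c : ℕ) (f : (ℕ → WithTop ℕ) → R)
    (w : ℕ → WithTop ℕ) (h : ¬(w c = y ∧ w (c + 1) = x)) (h' : ¬(w c = x ∧ w (c + 1) = y)) :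
    step (sortStay β z) (sortCross z) c f (relabel x y w) =
      step (sortStay β z) (sortCross z) c (fun w => f (relabel x y w)) w := by
  simp only [step, exch_relabel]
  simp only [relabel, sortStay_swap hxy hy β z h h', sortCross_swap hxy hy z h h']

/-- If `y` is directly to the left of `x`, both orders lead to the sorted word. -/
theorem step_of_adjacent (hxy : x ⋖ y) (hy : y ≠ ⊤) (β z : R) (c : ℕ) (f : (ℕ → WithTop ℕ) → R)
    (w : ℕ → WithTop ℕ) (hw : Unsorted x y w) (h : w c = y ∧ w (c + 1) = x) :
    step (sortStay β z) (sortCross z) c f w = f (relabel x y w) ∧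
      step (sortStay β z) (sortCross z) c f (relabel x y w) = f (relabel x y w) := by
  have h1 := hw.exch_eq_relabel hxy.lt.ne h.1 h.2
  constructor
  · simp [step, h1, h.1, h.2, sortStay, sortCross, hxy.lt.not_ge, hy]
  · simp [step, relabel, h.1, h.2, sortStay, sortCross, hxy.lt.le]

end relabel

section base
variable {R : Type*} [CommRing R] {x y : WithTop ℕ}

/-- In the absence of `y`, renaming `x` to `y` does not change the order of the labels. -/
theorem rowOp_relabel_of_forall_ne (hxy : x ⋖ y) (hy : y ≠ ⊤) (β z : R) (m : ℕ)
    (f f' : (ℕ → WithTop ℕ) → R)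
    (h : ∀ w, (∀ p, w p ≠ y) → f (relabel x y w) = f' w) (w : ℕ → WithTop ℕ)
    (hw : ∀ p, w p ≠ y) :
    rowOp (sortStay β z) (sortCross z) m f (relabel x y w) =
      rowOp (sortStay β z) (sortCross z) m f' w := by
  refine rowOp_induction (fun f f' => ∀ w, (∀ p, w p ≠ y) → f (relabel x y w) = f' w) ?_ h w hw
  intro c _ f f' hf w hw
  rw [step_relabel hxy hy _ _ _ _ _ (fun h => hw _ h.1) (fun h => hw _ h.2)]
  simp only [step]
  rw [hf w hw, hf (exch c w) fun p => hw _]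

/-- The comparison of an unsorted word with the sorted one: in a state for the sorted word the
paths of `x` and `y` either do not meet, and exchanging their names gives a state that ends with
`f'`, or they meet, and letting them cross at the first meeting gives a state that ends with `f`. -/
theorem rowOp_relabel_of_unsorted (hxy : x ⋖ y) (hy : y ≠ ⊤) (β z : R) (m : ℕ)
    (f f' : (ℕ → WithTop ℕ) → R)
    (h : ∀ w, Unsorted x y w → f (relabel x y w) = f w + f' w ∧ f' (relabel x y w) = 0)
    (w : ℕ → WithTop ℕ) (hw : Unsorted x y w) :
    rowOp (sortStay β z) (sortCross z) m f (relabel x y w) =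
        rowOp (sortStay β z) (sortCross z) m f w + rowOp (sortStay β z) (sortCross z) m f' w ∧
      rowOp (sortStay β z) (sortCross z) m f' (relabel x y w) = 0 := by
  refine rowOp_induction (fun f f' => ∀ w, Unsorted x y w →
    f (relabel x y w) = f w + f' w ∧ f' (relabel x y w) = 0) ?_ h w hw
  intro c _ f f' hf w hw
  by_cases hc : w c = y ∧ w (c + 1) = x
  · obtain ⟨h1, h2⟩ := step_of_adjacent hxy hy β z c f w hw hc
    obtain ⟨h3, h4⟩ := step_of_adjacent hxy hy β z c f' w hw hc
    rw [h1, h2, h3, h4, (hf w hw).2]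
    simp
  · rw [step_relabel hxy hy _ _ _ _ _ hc (hw.not_adjacent hxy.lt.ne c),
      step_relabel hxy hy _ _ _ _ _ hc (hw.not_adjacent hxy.lt.ne c)]
    obtain ⟨h1, h2⟩ := hf w hw
    obtain ⟨h3, h4⟩ := hf _ (hw.exch hc)
    simp only [step, h1, h2, h3, h4]
    constructor <;> ring

/-- The hypotheses of `rowOp_relabel_of_unsorted` at the end of the row that one of the labels `x`
and `y` leaves, the other one leaving the next row. -/
theorem exit_relabel_of_unsorted (hxy : x ⋖ y) (hy : y ≠ ⊤) (β z : R) (m : ℕ)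
    (G : (ℕ → WithTop ℕ) → R) (hG : ∀ w, (∃ p, w p = x ∨ w p = y) → G w = 0)
    (w : ℕ → WithTop ℕ) (hw : Unsorted x y w) :
    exit x (rowOp (sortStay β z) (sortCross z) m (exit y G)) (relabel x y w) =
        exit x (rowOp (sortStay β z) (sortCross z) m (exit y G)) w +
          exit y (rowOp (sortStay β z) (sortCross z) m (exit x G)) w ∧
      exit y (rowOp (sortStay β z) (sortCross z) m (exit x G)) (relabel x y w) = 0 := by
  obtain ⟨p, q, hpq, hp, hq, hr⟩ := hw
  have hne := hxy.lt.ne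
  have h0 : w 0 ≠ x := by
    by_cases h : 0 = p
    · rw [h, hp]; exact hne.symm
    · exact (hr 0 h (by omega)).1
  have hsx : Equiv.swap x y (w 0) = x ↔ w 0 = y := by
    rw [Equiv.swap_apply_eq_iff, Equiv.swap_apply_left]
  have hsy : Equiv.swap x y (w 0) = y ↔ w 0 = x := by
    rw [Equiv.swap_apply_eq_iff, Equiv.swap_apply_right]
  refine ⟨?_, by simp [exit, relabel, hsy, h0]⟩
  simp only [exit, relabel, hsx, h0, if_false, zero_add]
  split_ifs with hy0
  · obtain rfl : p = 0 := by
      by_contra h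
      exact (hr 0 (Ne.symm h) (by omega)).2 hy0
    refine rowOp_relabel_of_forall_ne hxy hy β z m _ _ ?_ (fun p => w (p + 1)) ?_
    · intro w hw
      have hsy : Equiv.swap x y (w 0) = y ↔ w 0 = x := by
        rw [Equiv.swap_apply_eq_iff, Equiv.swap_apply_right]
      simp only [exit, relabel, hsy]
      split_ifs with hx0
      · by_cases h : ∃ p, w (p + 1) = x
        · obtain ⟨p, hp⟩ := h
          rw [hG _ ⟨p, Or.inr (by simp [hp])⟩, hG _ ⟨p, Or.inl hp⟩]
        · push Not at h
          congr 1
          funext p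
          exact Equiv.swap_apply_of_ne_of_ne (h p) (hw _)
      · rfl
    · intro p
      by_cases h : p + 1 = q
      · rw [h, hq]; exact hne
      · exact (hr (p + 1) (by omega) h).2
  · rfl

end base

/-! ### The Demazure--Lascoux recursion for the sorting model -/

section sorting
variable {R : Type*} [CommRing R]

/-- The partition function of `j` rows of the sorting model, the first of them row `k`, with the
parameter `z r` in row `r`. In row `r` the label `r` leaves on the left. -/
noncomputable def sortPF (β : R) (z : ℕ → R) (m j k : ℕ) : (ℕ → WithTop ℕ) → R :=
  rowsPF (fun r => sortStay β (z r)) (fun r => sortCross (z r)) (fun r => (r : WithTop ℕ)) ⊤ m j k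

theorem sortPF_succ (β : R) (z : ℕ → R) (m j k : ℕ) :
    sortPF β z m (j + 1) k = rowOp (sortStay β (z k)) (sortCross (z k)) m
      (exit (k : WithTop ℕ) (sortPF β z m j (k + 1))) := by
  simp only [sortPF, rowsPF]

theorem sortPF_eq_zero (β : R) (z : ℕ → R) (m j k l : ℕ) (hl : l < k) (w : ℕ → WithTop ℕ)
    (hw : ∃ p, w p = (l : WithTop ℕ)) : sortPF β z m j k w = 0 :=
  rowsPF_eq_zero _ _ _ m (WithTop.coe_ne_top (a := l)) j k
    (fun k' h _ h0 => by have : k' = l := Nat.cast_inj (R := WithTop ℕ).1 h0; omega) w hw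

theorem map_sortStay {S : Type*} [CommRing S] (s : R →+* S) (β z : R) (t r : WithTop ℕ) :
    s (sortStay β z t r) = sortStay (s β) (s z) t r := by
  unfold sortStay; split_ifs <;> simp

theorem map_sortCross {S : Type*} [CommRing S] (s : R →+* S) (z : R) (t r : WithTop ℕ) :
    s (sortCross z t r) = sortCross (s z) t r := by
  unfold sortCross; split_ifs <;> simp

theorem map_sort_rowOp {S : Type*} [CommRing S] (s : R →+* S) (β z : R) (m : ℕ)
    (f : (ℕ → WithTop ℕ) → R) (w : ℕ → WithTop ℕ) :
    s (rowOp (sortStay β z) (sortCross z) m f w) =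
      rowOp (sortStay (s β) (s z)) (sortCross (s z)) m (fun w => s (f w)) w := by
  rw [map_rowOp]
  simp only [map_sortStay, map_sortCross]

theorem map_exit {α S : Type*} [DecidableEq α] [CommRing S] (s : R →+* S) (x : α)
    (f : (ℕ → α) → R) (w : ℕ → α) : s (exit x f w) = exit x (fun w => s (f w)) w := by
  unfold exit; split_ifs <;> simp

theorem map_sortPF (s : R →+* R) (β : R) (hβ : s β = β) (z : ℕ → R) (m j k : ℕ)
    (hz : ∀ r, k ≤ r → s (z r) = z r) (w : ℕ → WithTop ℕ) :
    s (sortPF β z m j k w) = sortPF β z m j k w := by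
  induction j generalizing k w with
  | zero => simp only [sortPF, rowsPF]; split_ifs <;> simp
  | succ j ih =>
    rw [sortPF_succ, map_sort_rowOp, hβ, hz k le_rfl]
    congr 1
    funext w
    rw [map_exit]
    congr 1
    funext w
    exact ih (k + 1) (fun r hr => hz r (by omega)) w

/-- The relation between the values of `f` at a word with the label `y` to the left of `x` and at
the sorted word: up to exact division by `A - B`, the second is the Demazure--Lascoux operator
applied to the first. -/
def ExchangeRel (β A B : R) (s : R →+* R) (x y : WithTop ℕ) (m : ℕ)
    (f : (ℕ → WithTop ℕ) → R) : Prop :=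
  ∀ w, Unsorted x y w → (∀ p, m ≤ p → w p = ⊤) →
    (A - B) * f (relabel x y w) = (A + β * A * B) * f w - (B + β * A * B) * s (f w) ∧
      s (f (relabel x y w)) = f (relabel x y w)

theorem ExchangeRel.step {β A B z : R} {s : R →+* R} (hβ : s β = β) (hz : s z = z)
    {x y : WithTop ℕ} (hxy : x ⋖ y) (hy : y ≠ ⊤) {m c : ℕ} (hc : c + 1 < m)
    {f : (ℕ → WithTop ℕ) → R} (hf : ExchangeRel β A B s x y m f) :
    ExchangeRel β A B s x y m (step (sortStay β z) (sortCross z) c f) := by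
  intro w hw hm
  by_cases h : w c = y ∧ w (c + 1) = x
  · obtain ⟨h1, h2⟩ := step_of_adjacent hxy hy β z c f w hw h
    rw [h1, h2, (hf w hw hm).2]
    exact ⟨by ring, rfl⟩
  · rw [step_relabel hxy hy _ _ _ _ _ h (hw.not_adjacent hxy.lt.ne c)]
    obtain ⟨h1, h2⟩ := hf w hw hm
    obtain ⟨h3, h4⟩ := hf _ (hw.exch h) fun p hp => by
      rw [exch_of_ne _ _ (by omega) (by omega), hm p hp]
    have e1 := map_sortStay s β z (w c) (w (c + 1))
    have e2 := map_sortCross s z (w c) (w (c + 1))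
    rw [hβ, hz] at e1
    rw [hz] at e2
    simp only [LascouxModel.step, map_add, map_mul, e1, e2, h2, h4, and_true]
    linear_combination sortStay β z (w c) (w (c + 1)) * h1 +
      sortCross z (w c) (w (c + 1)) * h3

theorem ExchangeRel.exit {β A B : R} {s : R →+* R} {x y l : WithTop ℕ} (hx : l ≠ x) (hy : l ≠ y)
    {m : ℕ} {f : (ℕ → WithTop ℕ) → R} (hf : ExchangeRel β A B s x y m f) :
    ExchangeRel β A B s x y (m + 1) (exit l f) := by
  intro w hw hm
  have hl : Equiv.swap x y (w 0) = l ↔ w 0 = l := by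
    rw [Equiv.swap_apply_eq_iff, Equiv.swap_apply_of_ne_of_ne hx hy]
  simp only [LascouxModel.exit, relabel, hl]
  split_ifs with h0
  · refine hf (fun p => w (p + 1)) ?_ fun p hp => hm _ (by omega)
    obtain ⟨p, q, hpq, hp, hq, hr⟩ := hw
    have hp0 : p ≠ 0 := by rintro rfl; exact hy (h0.symm.trans hp)
    obtain ⟨p, rfl⟩ := Nat.exists_eq_succ_of_ne_zero hp0
    obtain ⟨q, rfl⟩ := Nat.exists_eq_succ_of_ne_zero (show q ≠ 0 by omega)
    exact ⟨p, q, by omega, hp, hq, fun r h1 h2 => hr (r + 1) (by omega) (by omega)⟩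
  · simp

theorem ExchangeRel.mono {β A B : R} {s : R →+* R} {x y : WithTop ℕ} {m m' : ℕ} (h : m ≤ m')
    {f : (ℕ → WithTop ℕ) → R} (hf : ExchangeRel β A B s x y m' f) :
    ExchangeRel β A B s x y m f :=
  fun w hw hm => hf w hw fun p hp => hm p (h.trans hp)

/-- The relation at the two rows which the labels `x` and `y` leave. -/
theorem exchangeRel_twoRows [IsDomain R] {β A B : R} {s : R →+* R} (hβ : s β = β) (hA : s A = B)
    (hB : s B = A) (hq : B * (1 + β * A) ≠ 0) {x y : WithTop ℕ} (hxy : x ⋖ y) (hy : y ≠ ⊤)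
    (m : ℕ) (G : (ℕ → WithTop ℕ) → R) (hG : ∀ w, (∃ p, w p = x ∨ w p = y) → G w = 0)
    (hs : ∀ w, s (G w) = G w) :
    ExchangeRel β A B s x y m (rowOp (sortStay β A) (sortCross A) m
      (exit x (rowOp (sortStay β B) (sortCross B) m (exit y G)))) := by
  intro w hw hm
  have hS : ∀ w, s (rowOp (sortStay β A) (sortCross A) m
      (exit x (rowOp (sortStay β B) (sortCross B) m (exit y G))) w) =
      twoRowOp β B A m (exit x (exit y G)) w := by
    intro w
    rw [map_sort_rowOp, twoRowOp, ← exit_rowOp]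
    simp only [map_exit, map_sort_rowOp, hβ, hA, hB, hs]
  have hm' : ∀ p, m ≤ p → relabel x y w p = ⊤ := by
    intro p hp
    rw [relabel, swap_eq_top_iff hxy.lt hy, hm p hp]
  obtain ⟨h1, h2⟩ := rowOp_relabel_of_unsorted hxy hy β A m _ _
    (exit_relabel_of_unsorted hxy hy β B m G hG) w hw
  have h3 := twoRowOp_exchange β A B m hxy.lt hy G w (hm m le_rfl) (hm (m + 1) (by omega))
  have h4 := twoRowOp_exchange β A B m hxy.lt hy G _ (hm' m le_rfl) (hm' (m + 1) (by omega))
  rw [← hS, twoRowOp, ← exit_rowOp, twoRowOp, ← exit_rowOp] at h3 h4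
  rw [h2, mul_zero, sub_zero] at h4
  refine ⟨?_, (mul_left_cancel₀ hq h4).symm⟩
  rw [h1]
  linear_combination -h3

theorem natCast_covBy (i : ℕ) : (i : WithTop ℕ) ⋖ ((i + 1 : ℕ) : WithTop ℕ) :=
  WithTop.coe_covBy_coe.2 (Order.covBy_add_one i)

/-- The exchange relation for the partition function of the sorting model. -/
theorem exchangeRel_sortPF [IsDomain R] {β : R} {z : ℕ → R} {s : R →+* R} {i : ℕ} (hβ : s β = β)
    (hi : s (z i) = z (i + 1)) (hi' : s (z (i + 1)) = z i)
    (hz : ∀ r, r ≠ i → r ≠ i + 1 → s (z r) = z r) (hq : z (i + 1) * (1 + β * z i) ≠ 0)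
    (m j k : ℕ) (hk : k ≤ i) (hj : i + 1 < k + j) :
    ExchangeRel β (z i) (z (i + 1)) s (i : WithTop ℕ) ((i + 1 : ℕ) : WithTop ℕ) m
      (sortPF β z m j k) := by
  have hcov := natCast_covBy i
  have htop : ((i + 1 : ℕ) : WithTop ℕ) ≠ ⊤ := WithTop.coe_ne_top
  induction j generalizing k with
  | zero => omega
  | succ j ih =>
    rcases hk.lt_or_eq with h | rfl
    · have h1 := ih (k + 1) (by omega) (by omega)
      have h2 : ExchangeRel β (z i) (z (i + 1)) s (i : WithTop ℕ) ((i + 1 : ℕ) : WithTop ℕ) (m + 1)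
          (exit (k : WithTop ℕ) (sortPF β z m j (k + 1))) :=
        h1.exit (by simp only [ne_eq, Nat.cast_inj]; omega)
          (by simp only [ne_eq, Nat.cast_inj]; omega)
      rw [sortPF_succ]
      refine ExchangeRel.mono (Nat.le_succ m) ?_
      refine rowOp_induction (a' := sortStay β (z k)) (b' := sortCross (z k))
        (fun f _ => ExchangeRel β (z i) (z (i + 1)) s (i : WithTop ℕ)
          ((i + 1 : ℕ) : WithTop ℕ) (m + 1) f) ?_ (f' := 0) h2
      intro c hc f _ hf
      exact hf.step hβ (hz k (by omega) (by omega)) hcov htop (by omega)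
    · obtain ⟨j, rfl⟩ := Nat.exists_eq_succ_of_ne_zero (show j ≠ 0 by omega)
      rw [sortPF_succ, sortPF_succ]
      refine exchangeRel_twoRows hβ hi hi' hq hcov htop m _ ?_ ?_
      · rintro w ⟨p, hp | hp⟩
        · exact sortPF_eq_zero β z m _ _ k (by omega) w ⟨p, hp⟩
        · exact sortPF_eq_zero β z m _ _ (k + 1) (by omega) w ⟨p, hp⟩
      · exact map_sortPF s β hβ z m _ _ fun r hr => hz r (by omega) (by omega)

end sorting

/-! ### The word on the top boundary -/

/-- The parameter `z_k`, with rows numbered by natural numbers from `0` on. -/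
noncomputable def rowVar (n k : ℕ) : Poly n := if h : k < n + 1 then X ⟨k, h⟩ else 0

theorem rowVar_val {n : ℕ} (i : Fin (n + 1)) : rowVar n i = X i :=
  dif_pos i.isLt

/-- The column at whose top the color `c_i` is. -/
def topCol {n : ℕ} (lam : Fin (n + 1) → ℕ) (i : Fin (n + 1)) : ℕ := lam i.rev + i

theorem topCol_strictMono {n : ℕ} {lam : Fin (n + 1) → ℕ} (hlam : Antitone lam) :
    StrictMono (topCol lam) := by
  intro i j h
  have := hlam (Fin.rev_le_rev.2 h.le)
  unfold topCol
  have : (i : ℕ) < j := h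
  omega

open Classical in
/-- The color at the top of column `p`. -/
noncomputable def topLabel {n : ℕ} (lam : Fin (n + 1) → ℕ) (p : ℕ) : Label n :=
  if h : ∃ i, p = topCol lam i then some h.choose else none

/-- The color `c_i` renamed `v i`; the label `0` becomes the largest label `⊤`. -/
def rowLabel {n : ℕ} (v : Equiv.Perm (Fin (n + 1))) : Label n → WithTop ℕ
  | none => ⊤
  | some i => ((v i : ℕ) : WithTop ℕ)

/-- The word on the top boundary, with the color `c_i` renamed `v i`. Words are infinite; all
letters beyond the columns of the grid are `⊤`. -/
noncomputable def topWord {n : ℕ} (lam : Fin (n + 1) → ℕ) (v : Equiv.Perm (Fin (n + 1))) (p : ℕ) :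
    WithTop ℕ :=
  rowLabel v (topLabel lam p)

section topWord
variable {n : ℕ} {lam : Fin (n + 1) → ℕ}

theorem topLabel_topCol (hlam : Antitone lam) (i : Fin (n + 1)) :
    topLabel lam (topCol lam i) = some i := by
  have h : ∃ j, topCol lam i = topCol lam j := ⟨i, rfl⟩
  have h' : h.choose = i := (topCol_strictMono hlam).injective h.choose_spec.symm
  rw [topLabel, dif_pos h, h']

theorem topLabel_eq_none {p : ℕ} (h : ∀ i, p ≠ topCol lam i) : topLabel lam p = none :=
  dif_neg (by push Not; exact h)

theorem topLabel_eq_some_iff (hlam : Antitone lam) {p : ℕ} {i : Fin (n + 1)} :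
    topLabel lam p = some i ↔ p = topCol lam i := by
  constructor
  · intro h
    by_contra hp
    by_cases h' : ∃ j, p = topCol lam j
    · obtain ⟨j, rfl⟩ := h'
      rw [topLabel_topCol hlam, Option.some_inj] at h
      exact hp (by rw [h])
    · push Not at h'
      simp [topLabel_eq_none h'] at h
  · rintro rfl
    exact topLabel_topCol hlam i

theorem topWord_topCol (hlam : Antitone lam) (v : Equiv.Perm (Fin (n + 1))) (i : Fin (n + 1)) :
    topWord lam v (topCol lam i) = ((v i : ℕ) : WithTop ℕ) := by
  rw [topWord, topLabel_topCol hlam]; rfl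

theorem topWord_eq_top (v : Equiv.Perm (Fin (n + 1))) {p : ℕ} (h : ∀ i, p ≠ topCol lam i) :
    topWord lam v p = ⊤ := by
  rw [topWord, topLabel_eq_none h]; rfl

theorem topWord_eq_val_iff (hlam : Antitone lam) (v : Equiv.Perm (Fin (n + 1))) {p : ℕ}
    {k : Fin (n + 1)} :
    topWord lam v p = ((k : ℕ) : WithTop ℕ) ↔ p = topCol lam (v⁻¹ k) := by
  by_cases h : ∃ i, p = topCol lam i
  · obtain ⟨i, rfl⟩ := h
    rw [topWord_topCol hlam, Nat.cast_inj, Fin.val_inj,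
      (topCol_strictMono hlam).injective.eq_iff, Equiv.Perm.eq_inv_iff_eq]
  · push Not at h
    rw [topWord_eq_top v h]
    exact iff_of_false (WithTop.coe_ne_top (a := (k : ℕ))).symm (h _)

theorem topWord_simpleSwap_mul (hlam : Antitone lam) (v : Equiv.Perm (Fin (n + 1))) (i : Fin n) :
    topWord lam (simpleSwap i * v) =
      relabel ((i : ℕ) : WithTop ℕ) ((i + 1 : ℕ) : WithTop ℕ) (topWord lam v) := by
  funext p
  by_cases h : ∃ j, p = topCol lam j
  · obtain ⟨j, rfl⟩ := h
    rw [relabel, topWord_topCol hlam, topWord_topCol hlam, Equiv.Perm.mul_apply, simpleSwap,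
      Equiv.swap_apply_def, Equiv.swap_apply_def]
    simp only [Nat.cast_inj, Fin.ext_iff, Fin.val_castSucc, Fin.val_succ]
    split_ifs <;> rfl
  · push Not at h
    rw [relabel, topWord_eq_top _ h, topWord_eq_top _ h]
    exact ((swap_eq_top_iff (natCast_covBy i).lt (WithTop.coe_ne_top (a := (i + 1 : ℕ))) ⊤).2
      rfl).symm

theorem unsorted_topWord (hlam : Antitone lam) (v : Equiv.Perm (Fin (n + 1))) {i : Fin n}
    (h : v⁻¹ i.succ < v⁻¹ i.castSucc) :
    Unsorted ((i : ℕ) : WithTop ℕ) ((i + 1 : ℕ) : WithTop ℕ) (topWord lam v) := by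
  have hx : ∀ p, topWord lam v p = ((i : ℕ) : WithTop ℕ) ↔ p = topCol lam (v⁻¹ i.castSucc) :=
    fun p => topWord_eq_val_iff hlam v (k := i.castSucc)
  have hy : ∀ p, topWord lam v p = ((i + 1 : ℕ) : WithTop ℕ) ↔ p = topCol lam (v⁻¹ i.succ) :=
    fun p => topWord_eq_val_iff hlam v (k := i.succ)
  exact ⟨_, _, topCol_strictMono hlam h, (hy _).2 rfl, (hx _).2 rfl,
    fun r h1 h2 => ⟨fun h => h2 ((hx r).1 h), fun h => h1 ((hy r).1 h)⟩⟩

theorem topCol_lt (hlam : Antitone lam) {m : ℕ} (hm : n + 1 + lam 0 ≤ m) (i : Fin (n + 1)) :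
    topCol lam i < m := by
  have := hlam (Fin.zero_le i.rev)
  unfold topCol
  omega

theorem topWord_eq_top_of_le (hlam : Antitone lam) (v : Equiv.Perm (Fin (n + 1))) {m : ℕ}
    (hm : n + 1 + lam 0 ≤ m) {p : ℕ} (hp : m ≤ p) :
    topWord lam v p = ⊤ :=
  topWord_eq_top v fun i h => by have := topCol_lt hlam hm i; omega

end topWord

/-! ### The ground state -/

section ground
variable {R : Type*} [CommRing R]

/-- If the label `k` starts row `k` as the smallest label in column `c`, it has to go straight to
the left: each empty column on its way contributes `z`. -/
theorem rowOp_exit_of_lt (β z : R) (k : ℕ) (F : (ℕ → WithTop ℕ) → R)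
    (hF : ∀ w, (∃ p, w p = (k : WithTop ℕ)) → F w = 0) (c : ℕ) (w : ℕ → WithTop ℕ)
    (hc : w c = (k : WithTop ℕ)) (hw : ∀ p < c, (k : WithTop ℕ) < w p) :
    rowOp (sortStay β z) (sortCross z) c (exit (k : WithTop ℕ) F) w =
      (∏ p ∈ Finset.range c, if w p = ⊤ then z else 1) *
        F (fun p => if p < c then w p else w (p + 1)) := by
  -- A label `k` that has been dropped cannot leave row `k` any more.
  have hzero : ∀ (c : ℕ) (w : ℕ → WithTop ℕ), (∃ p, c < p ∧ w p = (k : WithTop ℕ)) →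
      rowOp (sortStay β z) (sortCross z) c (exit (k : WithTop ℕ) F) w = 0 := by
    intro c
    induction c with
    | zero =>
      rintro w ⟨p, hp, h⟩
      simp only [rowOp, exit]
      rw [hF _ ⟨p - 1, by rw [Nat.sub_add_cancel hp, h]⟩, ite_self]
    | succ c ih =>
      rintro w ⟨p, hp, h⟩
      rw [rowOp, step, ih w ⟨p, by omega, h⟩,
        ih _ ⟨p, by omega, by rw [exch_of_ne _ _ (by omega) (by omega), h]⟩]
      ring
  induction c generalizing w with
  | zero => simp [rowOp, exit, hc]
  | succ c ih =>
    have hlt := hw c (by omega)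
    have h1 := ih (exch c w) (by rw [exch_left, hc]) fun p hp => by
      rw [exch_of_ne _ _ (by omega) (by omega)]; exact hw p (by omega)
    have h2 : (∏ p ∈ Finset.range c, if exch c w p = ⊤ then z else 1) =
        ∏ p ∈ Finset.range c, if w p = ⊤ then z else 1 := by
      refine Finset.prod_congr rfl fun p hp => ?_
      have := Finset.mem_range.1 hp
      rw [exch_of_ne _ _ (by omega) (by omega)]
    have h3 : (fun p => if p < c then exch c w p else exch c w (p + 1)) =
        fun p => if p < c + 1 then w p else w (p + 1) := by
      funext p
      rcases lt_trichotomy p c with h | rfl | h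
      · rw [if_pos h, if_pos (by omega), exch_of_ne _ _ (by omega) (by omega)]
      · simp
      · rw [if_neg (by omega), if_neg (by omega), exch_of_ne _ _ (by omega) (by omega)]
    rw [h2, h3] at h1
    rw [rowOp, step, hc, h1, hzero c w ⟨c + 1, by omega, hc⟩, Finset.prod_range_succ]
    unfold sortCross
    rw [if_neg hlt.not_ge]
    split_ifs <;> ring

theorem rowOp_eq_of_top (β z : R) (f : (ℕ → WithTop ℕ) → R) (w : ℕ → WithTop ℕ) {c m : ℕ}
    (hcm : c ≤ m) (hw : ∀ p, c < p → w p = ⊤) :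
    rowOp (sortStay β z) (sortCross z) m f w = rowOp (sortStay β z) (sortCross z) c f w := by
  induction m, hcm using Nat.le_induction with
  | base => rfl
  | succ m hm ih => simp [rowOp, step, sortStay, sortCross, hw (m + 1) (by omega), ih]

/-- For `w = 1` the only state that contributes has weight `z^λ`. -/
theorem sortPF_topWord_rev {n m : ℕ} {lam : Fin (n + 1) → ℕ} (hlam : Antitone lam)
    (hm : n + 1 + lam 0 ≤ m) (β : R) (z : ℕ → R) :
    sortPF β z m (n + 1) 0 (topWord lam Fin.revPerm) = ∏ i, z (i : Fin (n + 1)) ^ lam i := by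
  set T := topWord lam Fin.revPerm with hT
  have hmono := topCol_strictMono hlam
  -- The last `i` rows, with the word that remains after each earlier row has removed its label.
  have main : ∀ i ≤ n + 1, ∀ d, (∀ t : Fin (n + 1), topCol lam t < d ↔ (t : ℕ) < i) →
      sortPF β z m i (n + 1 - i) (fun p => if p < d then T p else ⊤) =
        ∏ t ∈ Finset.univ.filter (fun t : Fin (n + 1) => (t : ℕ) < i), z t.rev ^ lam t.rev := by
    intro i
    induction i with
    | zero =>
      intro _ d hd
      have h : ∀ p, (if p < d then T p else ⊤) = ⊤ := by
        intro p
        split_ifs with h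
        · refine topWord_eq_top _ fun t ht => ?_
          have := (hd t).1 (by omega)
          omega
        · rfl
      simp only [sortPF, rowsPF, h, implies_true, if_true, Nat.not_lt_zero, Finset.filter_false,
        Finset.prod_empty]
    | succ i ih =>
      intro hi d hd
      obtain ⟨t, ht⟩ : ∃ t : Fin (n + 1), (t : ℕ) = i := ⟨⟨i, hi⟩, rfl⟩
      have hk : n + 1 - (i + 1) = (t.rev : ℕ) := by rw [Fin.val_rev, ht]
      have hk' : n + 1 - (i + 1) + 1 = n + 1 - i := by omega
      have hcd : topCol lam t < d := (hd t).2 (by omega)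
      have hc : T (topCol lam t) = ((t.rev : ℕ) : WithTop ℕ) := topWord_topCol hlam _ t
      have hfin : ∀ p, T p ≠ ⊤ → ∃ t', p = topCol lam t' := by
        intro p hp
        by_contra h
        push Not at h
        exact hp (topWord_eq_top _ h)
      rw [sortPF_succ, hk', rowOp_eq_of_top β _ _ _ (topCol_lt hlam hm t).le, hk,
        rowOp_exit_of_lt]
      · have hT' : (fun p => if p < topCol lam t then if p < d then T p else ⊤ else
            if p + 1 < d then T (p + 1) else ⊤) = fun p => if p < topCol lam t then T p else ⊤ := by
          funext p
          split_ifs with h1 h2 h3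
          · rfl
          · omega
          · by_contra h
            obtain ⟨t', ht'⟩ := hfin _ h
            have h4 := (hd t').1 (by omega)
            have h5 : topCol lam t' ≤ topCol lam t := hmono.monotone (Fin.le_def.2 (by omega))
            omega
          · rfl
        -- Of the `lam t.rev + t` columns to the left, `t` hold a color.
        have hcard : ((Finset.range (topCol lam t)).filter fun p => T p = ⊤).card = lam t.rev := by
          have h1 := Finset.card_filter_add_card_filter_not (s := Finset.range (topCol lam t))
            (fun p => T p = ⊤)
          have h2 : ((Finset.range (topCol lam t)).filter fun p => ¬T p = ⊤) =
              (Finset.Iio t).image (topCol lam) := by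
            ext p
            simp only [Finset.mem_filter, Finset.mem_range, Finset.mem_image, Finset.mem_Iio]
            constructor
            · rintro ⟨h1, h2⟩
              obtain ⟨t', rfl⟩ := hfin p h2
              exact ⟨t', hmono.lt_iff_lt.1 h1, rfl⟩
            · rintro ⟨t', h1, rfl⟩
              refine ⟨hmono h1, ?_⟩
              rw [hT, topWord_topCol hlam]
              exact WithTop.coe_ne_top
          rw [h2, Finset.card_image_of_injective _ hmono.injective, Fin.card_Iio,
            Finset.card_range] at h1
          unfold topCol at h1 ⊢
          omega
        have hprod : (∏ p ∈ Finset.range (topCol lam t),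
            if (if p < d then T p else ⊤) = ⊤ then z (t.rev : ℕ) else 1) =
            z (t.rev : ℕ) ^ lam t.rev := by
          rw [← hcard, ← Finset.prod_const, Finset.prod_filter]
          refine Finset.prod_congr rfl fun p hp => ?_
          rw [if_pos (lt_trans (Finset.mem_range.1 hp) hcd)]
        have hins : (Finset.univ.filter fun t' : Fin (n + 1) => (t' : ℕ) < i + 1) =
            insert t (Finset.univ.filter fun t' : Fin (n + 1) => (t' : ℕ) < i) := by
          ext t'
          simp only [Finset.mem_filter, Finset.mem_univ, true_and, Finset.mem_insert, Fin.ext_iff]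
          omega
        rw [hT', hprod, hins, Finset.prod_insert (by simp [ht]),
          ih (by omega) _ fun t' => by rw [hmono.lt_iff_lt, Fin.lt_def, ht]]
      · exact fun w hw => sortPF_eq_zero β z m _ _ _ (by omega) w hw
      · rw [if_pos hcd, hc]
      · intro p hp
        rw [if_pos (hp.trans hcd)]
        by_cases h : T p = ⊤
        · rw [h]; exact WithTop.coe_lt_top _
        · obtain ⟨t', rfl⟩ := hfin p h
          rw [hT, topWord_topCol hlam, Nat.cast_lt]
          exact Fin.rev_lt_rev.2 (hmono.lt_iff_lt.1 hp)
      · intro p hp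
        split_ifs with h1
        · by_contra h
          obtain ⟨t', rfl⟩ := hfin p h
          have h2 := (hd t').1 h1
          have h3 : topCol lam t' ≤ topCol lam t := hmono.monotone (Fin.le_def.2 (by omega))
          omega
        · rfl
  have h := main (n + 1) le_rfl m fun t => ⟨fun _ => t.isLt, fun _ => topCol_lt hlam hm t⟩
  have hTm : (fun p => if p < m then T p else ⊤) = T := by
    funext p
    split_ifs with h1
    · rfl
    · exact (topWord_eq_top_of_le hlam _ hm (not_lt.1 h1)).symm
  rw [hTm, Nat.sub_self] at h
  rw [h, Finset.filter_true_of_mem fun t _ => t.isLt]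
  exact Equiv.prod_comp Fin.revPerm fun i : Fin (n + 1) => z i ^ lam i

end ground

/-! ### Reduced words -/

section reduced
variable {n : ℕ}

theorem wordProd_cons (i : Fin n) (l : List (Fin n)) :
    wordProd (i :: l) = simpleSwap i * wordProd l := by simp [wordProd]

/-- The exchange condition: a transposition that shortens a product of simple transpositions
amounts to deleting one of the factors. -/
theorem exists_wordProd_eq_swap_mul (l : List (Fin n)) (a b : Fin (n + 1)) (hab : a < b)
    (h : (wordProd l)⁻¹ b < (wordProd l)⁻¹ a) :
    ∃ l' : List (Fin n), l'.length + 1 = l.length ∧ wordProd l' = Equiv.swap a b * wordProd l := by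
  induction l generalizing a b with
  | nil => simp [wordProd] at h; exact absurd hab h.not_gt
  | cons j t ih =>
    rw [wordProd_cons, mul_inv_rev, Equiv.Perm.mul_apply, Equiv.Perm.mul_apply] at h
    have hj : (simpleSwap j)⁻¹ = simpleSwap j := Equiv.swap_inv _ _
    rw [hj] at h
    by_cases hlt : simpleSwap j a < simpleSwap j b
    · obtain ⟨l', h1, h2⟩ := ih _ _ hlt h
      refine ⟨j :: l', by simp [h1], ?_⟩
      rw [wordProd_cons, h2, wordProd_cons, ← mul_assoc, ← mul_assoc]
      congr 1
      rw [Equiv.mul_swap_eq_swap_mul]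
      simp only [simpleSwap, Equiv.swap_apply_self]
    · refine ⟨t, rfl, ?_⟩
      have hab' : a = j.castSucc ∧ b = j.succ := by
        unfold simpleSwap at hlt
        rw [Equiv.swap_apply_def, Equiv.swap_apply_def] at hlt
        simp only [Fin.ext_iff, Fin.lt_def, Fin.val_castSucc, Fin.val_succ] at *
        split_ifs at hlt <;> (try simp only [Fin.val_castSucc, Fin.val_succ] at hlt) <;> omega
      rw [hab'.1, hab'.2, wordProd_cons, ← mul_assoc]
      simp [simpleSwap]

/-- In a reduced word the first factor exchanges two values that are in order before. -/
theorem IsReducedWord.of_cons {i : Fin n} {l : List (Fin n)}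
    (h : IsReducedWord (wordProd (i :: l)) (i :: l)) :
    IsReducedWord (wordProd l) l ∧
      (wordProd l)⁻¹ i.castSucc < (wordProd l)⁻¹ i.succ := by
  refine ⟨⟨rfl, fun l' hl' => ?_⟩, ?_⟩
  · have := h.2 (i :: l') (by rw [wordProd_cons, wordProd_cons, hl'])
    simpa using this
  · by_contra hlt
    have hne : (wordProd l)⁻¹ i.castSucc ≠ (wordProd l)⁻¹ i.succ := fun h =>
      (Fin.castSucc_lt_succ (i := i)).ne ((wordProd l)⁻¹.injective h)
    obtain ⟨l', h1, h2⟩ := exists_wordProd_eq_swap_mul l i.castSucc i.succ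
      (Fin.castSucc_lt_succ (i := i)) (lt_of_le_of_ne (not_lt.1 hlt) hne.symm)
    have := h.2 l' (by rw [h2, wordProd_cons, simpleSwap])
    simp only [List.length_cons] at this
    omega

theorem wLong_mul (u w : Equiv.Perm (Fin (n + 1))) : wLong (u * w) = u * wLong w := mul_assoc _ _ _

/-- The sorting model computes `ϖ_{i_1} ⋯ ϖ_{i_l} z^λ` for every reduced word. -/
theorem demazureLascouxWord_eq_sortPF {m : ℕ} {lam : Fin (n + 1) → ℕ} (hlam : Antitone lam)
    (hm : n + 1 + lam 0 ≤ m) (l : List (Fin n)) (hl : IsReducedWord (wordProd l) l) :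
    demazureLascouxWord l (zPow lam) =
      sortPF (beta n) (rowVar n) m (n + 1) 0 (topWord lam (wLong (wordProd l))) := by
  induction l with
  | nil =>
    have : wLong (wordProd ([] : List (Fin n))) = Fin.revPerm := by simp [wordProd, wLong]
    rw [this, sortPF_topWord_rev hlam hm]
    simp [demazureLascouxWord, zPow, rowVar_val]
  | cons i l ih =>
    obtain ⟨hl', hi⟩ := hl.of_cons
    rw [wordProd_cons, wLong_mul, topWord_simpleSwap_mul hlam]
    refine (demazureLascoux_unique i _ _ ?_).symm
    have ih' : l.foldr demazureLascoux (zPow lam) = _ := ih hl'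
    rw [ih']
    have hv : (wLong (wordProd l))⁻¹ i.succ < (wLong (wordProd l))⁻¹ i.castSucc := by
      rw [wLong, mul_inv_rev, Equiv.Perm.mul_apply, Equiv.Perm.mul_apply]
      exact Fin.rev_lt_rev.2 hi
    have hc : rowVar n (i : ℕ) = X i.castSucc := rowVar_val i.castSucc
    have hs : rowVar n (i + 1 : ℕ) = X i.succ := rowVar_val i.succ
    have hrel := exchangeRel_sortPF (β := beta n) (z := rowVar n)
      (s := (rename (simpleSwap i) : Poly n →ₐ[Polynomial ℤ] Poly n).toRingHom) (i := i)
      (by simp [beta]) (by simp [hc, hs, simpleSwap]) (by simp [hc, hs, simpleSwap])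
      (by
        intro r h1 h2
        unfold rowVar
        split_ifs with h
        · have : simpleSwap i ⟨r, h⟩ = ⟨r, h⟩ :=
            Equiv.swap_apply_of_ne_of_ne (by simpa [Fin.ext_iff] using h1)
              (by simpa [Fin.ext_iff] using h2)
          simp [this]
        · simp)
      (by
        rw [hc, hs]
        refine mul_ne_zero (X_ne_zero _) fun h => ?_
        have := congrArg (eval fun _ => 0) h
        simp [beta] at this)
      m (n + 1) 0 (Nat.zero_le _) (by omega) _ (unsorted_topWord hlam _ hv)
      (fun p hp => topWord_eq_top_of_le hlam _ hm hp)
    rw [hc, hs] at hrel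
    exact hrel.1

end reduced

/-! ### The vertices of the colored model -/

section colored
variable {n : ℕ} (w : Equiv.Perm (Fin (n + 1)))

/-- Weight of the vertex that keeps the colors `t` (top) and `r` (right). -/
noncomputable def colorStay (z : Poly n) : Label n → Label n → Poly n
  | none, none => 1
  | none, some _ => 1 + beta n * z
  | some _, none => 1
  | some t, some r => if t < r then if NonCrossing w t r then 1 else 0 else 1

/-- Weight of the vertex that exchanges the colors `t` (top) and `r` (right). It is `0` if `t = r`,
since exchanging equal colors is the same as keeping them. -/
noncomputable def colorCross (z : Poly n) : Label n → Label n → Poly n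
  | none, none => 0
  | none, some _ => z
  | some _, none => 0
  | some t, some r => if t < r then 1 else 0

theorem elim_vertexType (z : Poly n) (l t r b : Label n) :
    ((vertexType w l t r b).elim 0 fun x => x.weight z) =
      (if l = t ∧ b = r then colorStay w z t r else 0) +
        (if l = r ∧ b = t then colorCross z t r else 0) := by
  rcases l with _ | l <;> rcases t with _ | t <;> rcases r with _ | r <;> rcases b with _ | b
  case some.some.some.some =>
    simp only [vertexType, colorStay, colorCross, Option.some_inj]
    rcases lt_trichotomy t r with h | rfl | h
    · by_cases h1 : l = t
      · subst h1
        by_cases h2 : b = r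
        · subst h2
          by_cases h3 : NonCrossing w l b <;>
            simp [h, h.not_gt, h.ne, h3, VertexType.weight]
        · simp [h.ne, h2, Ne.symm h2]
      · by_cases h2 : l = r
        · subst h2
          by_cases h3 : b = t
          · subst h3; simp [h, h.ne', VertexType.weight]
          · simp [h.ne', h3, Ne.symm h3]
        · simp [h1, h2]
    · by_cases h1 : l = t
      · subst h1
        by_cases h2 : b = l
        · subst h2; simp [VertexType.weight]
        · simp [h2, Ne.symm h2]
      · simp [h1]
    · by_cases h1 : l = t
      · subst h1
        by_cases h2 : b = r
        · subst h2; simp [h, h.not_gt, VertexType.weight]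
        · simp [h.ne', h2, Ne.symm h2]
      · have h4 : ¬(l = r ∧ t = b ∧ t < l) := by rintro ⟨rfl, -, h4⟩; exact h.not_gt h4
        simp [h1, h4, h.not_gt]
  all_goals
    simp only [vertexType, colorStay, colorCross]
    first
    | simp [VertexType.weight]; done
    | (split_ifs <;> simp_all [VertexType.weight])

end colored

/-! ### From labelings to words -/

section sums
variable {α R : Type*} [Fintype α] [DecidableEq α] [CommRing R]

/-- The weight of a vertex with the labels `l`, `t`, `r`, `u` on the left, top, right, bottom. -/
def vertexWeight (a b : α → α → R) (l t r u : α) : R :=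
  (if l = t ∧ u = r then a t r else 0) + (if l = r ∧ u = t then b t r else 0)

theorem sum_fin_cons {j : ℕ} {β : Type*} [Fintype β] (F : (Fin (j + 1) → β) → R) :
    ∑ g, F g = ∑ x, ∑ g : Fin j → β, F (Fin.cons x g) := by
  rw [← (Fin.consEquiv fun _ => β).sum_comp, Fintype.sum_prod_type]
  rfl

theorem sum_fin_snoc {j : ℕ} {β : Type*} [Fintype β] (F : (Fin (j + 1) → β) → R) :
    ∑ g, F g = ∑ x, ∑ g : Fin j → β, F (Fin.snoc g x) := by
  rw [← (Fin.snocEquiv fun _ => β).sum_comp, Fintype.sum_prod_type]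
  rfl

theorem sum_fin_snoc_ite {j : ℕ} {β : Type*} [Fintype β] [DecidableEq β] (r : β)
    (F : (Fin (j + 1) → β) → R) :
    ∑ g, (if g (Fin.last j) = r then F g else 0) = ∑ g : Fin j → β, F (Fin.snoc g r) := by
  rw [sum_fin_snoc, Finset.sum_eq_single r]
  · simp only [Fin.snoc_last, if_true]
  · intro x _ hx
    simp only [Fin.snoc_last, if_neg hx, Finset.sum_const_zero]
  · intro h; exact absurd (Finset.mem_univ r) h

/-- The word after a row: the left label `x` of the row, its bottom labels `μ`, and the letters
of `w` that are not part of the row. -/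
def outWord {α : Type*} {m : ℕ} (x : α) (μ : Fin m → α) (w : ℕ → α) : ℕ → α
  | 0 => x
  | p + 1 => if h : p < m then μ ⟨p, h⟩ else w (p + 1)

theorem rowOp_eq_sum (a b : α → α → R) (m : ℕ) (f : (ℕ → α) → R) (w : ℕ → α) :
    rowOp a b m f w = ∑ h : Fin (m + 1) → α,
      if h (Fin.last m) = w m then ∑ μ : Fin m → α,
        (∏ c : Fin m, vertexWeight a b (h c.castSucc) (w c) (h c.succ) (μ c)) *
          f (outWord (h 0) μ w) else 0 := by
  induction m generalizing w with
  | zero =>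
    rw [sum_fin_snoc_ite, Fintype.sum_unique, Fintype.sum_unique, Finset.univ_eq_empty,
      Finset.prod_empty, one_mul, rowOp]
    congr 1
    funext p
    cases p with
    | zero => rfl
    | succ p => simp [outWord]
  | succ m ih =>
    -- The right-most vertex is a sum over its left label `l` and its bottom label `u`.
    have key : ∀ g : (ℕ → α) → R, step a b m g w =
        ∑ l, ∑ u, vertexWeight a b l (w m) (w (m + 1)) u *
          g (Function.update (Function.update w m l) (m + 1) u) := by
      intro g
      have h1 : Function.update (Function.update w m (w m)) (m + 1) (w (m + 1)) = w := by simp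
      have h2 : Function.update (Function.update w m (w (m + 1))) (m + 1) (w m) = exch m w := by
        funext p
        by_cases hp : p = m + 1
        · subst hp; simp
        by_cases hp' : p = m
        · subst hp'; simp
        rw [exch_of_ne _ _ hp' hp]; simp [hp, hp']
      simp only [vertexWeight, add_mul, Finset.sum_add_distrib, ite_mul, zero_mul, ite_and,
        Finset.sum_ite_eq', Finset.sum_ite_irrel, Finset.sum_const_zero, Finset.mem_univ, if_true,
        h1, h2, step]
    rw [rowOp, key, sum_fin_snoc_ite]
    have hout : ∀ (h : Fin (m + 1) → α) (μ : Fin m → α) (u : α),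
        outWord (h 0) μ (Function.update (Function.update w m (h (Fin.last m))) (m + 1) u) =
          outWord (h 0) (Fin.snoc μ u : Fin (m + 1) → α) w := by
      intro h μ u
      funext p
      cases p with
      | zero => rfl
      | succ p =>
        simp only [outWord]
        rcases lt_trichotomy p m with hp | rfl | hp
        · have : (⟨p, by omega⟩ : Fin (m + 1)) = Fin.castSucc ⟨p, hp⟩ := rfl
          rw [dif_pos hp, dif_pos (by omega), this, Fin.snoc_castSucc]
        · have : (⟨p, by omega⟩ : Fin (p + 1)) = Fin.last p := rfl
          rw [dif_neg (by omega), dif_pos (by omega), this, Fin.snoc_last]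
          simp
        · rw [dif_neg (by omega), dif_neg (by omega)]
          rw [Function.update_of_ne (by omega), Function.update_of_ne (by omega)]
    have hl : ∀ l u, rowOp a b m f (Function.update (Function.update w m l) (m + 1) u) =
        ∑ h : Fin (m + 1) → α, if h (Fin.last m) = l then ∑ μ : Fin m → α,
          (∏ c : Fin m, vertexWeight a b (h c.castSucc) (w c) (h c.succ) (μ c)) *
            f (outWord (h 0) (Fin.snoc μ u : Fin (m + 1) → α) w) else 0 := by
      intro l u
      rw [ih]
      refine Finset.sum_congr rfl fun h _ => ?_
      rw [Function.update_of_ne (by omega), Function.update_self]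
      split_ifs with hl
      · subst hl
        refine Finset.sum_congr rfl fun μ _ => ?_
        rw [hout]
        congr 1
        refine Finset.prod_congr rfl fun c _ => ?_
        rw [Function.update_of_ne (by omega), Function.update_of_ne (by omega)]
      · rfl
    simp only [hl]
    calc _ = ∑ l, ∑ h : Fin (m + 1) → α, if h (Fin.last m) = l then
              ∑ u, ∑ μ : Fin m → α, vertexWeight a b l (w m) (w (m + 1)) u *
              ((∏ c : Fin m, vertexWeight a b (h c.castSucc) (w c) (h c.succ) (μ c)) *
              f (outWord (h 0) (Fin.snoc μ u : Fin (m + 1) → α) w)) else 0 := by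
          refine Finset.sum_congr rfl fun l _ => ?_
          simp only [Finset.mul_sum, mul_ite, mul_zero]
          refine Finset.sum_comm.trans (Finset.sum_congr rfl fun h _ => ?_)
          split_ifs <;> simp
      _ = ∑ h : Fin (m + 1) → α, ∑ u, ∑ μ : Fin m → α,
              vertexWeight a b (h (Fin.last m)) (w m) (w (m + 1)) u *
              ((∏ c : Fin m, vertexWeight a b (h c.castSucc) (w c) (h c.succ) (μ c)) *
              f (outWord (h 0) (Fin.snoc μ u : Fin (m + 1) → α) w)) := by
          rw [Finset.sum_comm]
          refine Finset.sum_congr rfl fun h _ => ?_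
          rw [Finset.sum_ite_eq]
          simp
      _ = _ := by
          refine Finset.sum_congr rfl fun h _ => ?_
          rw [sum_fin_snoc]
          refine Finset.sum_congr rfl fun u _ => Finset.sum_congr rfl fun μ _ => ?_
          have h0 : (Fin.snoc h (w (m + 1)) : Fin (m + 2) → α) 0 = h 0 :=
            Fin.snoc_castSucc (α := fun _ => α) (w (m + 1)) h 0
          rw [Fin.prod_univ_castSucc, h0]
          simp only [Fin.snoc_castSucc, Fin.snoc_last, Fin.succ_last, Fin.val_last,
            Fin.val_castSucc, Fin.succ_castSucc]
          ring

/-- The word of the labels on the `m` vertical edges between two rows. -/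
def wordOf {α : Type*} {m : ℕ} (e : α) (κ : Fin m → α) (p : ℕ) : α :=
  if h : p < m then κ ⟨p, h⟩ else e

theorem wordOf_val {α : Type*} {m : ℕ} (e : α) (κ : Fin m → α) (c : Fin m) : wordOf e κ c = κ c :=
  dif_pos c.isLt

theorem rowOp_exit_eq_sum (a b : α → α → R) (m : ℕ) (x e : α) (f : (ℕ → α) → R) (κ : Fin m → α) :
    rowOp a b m (exit x f) (wordOf e κ) = ∑ h : Fin (m + 1) → α,
      if h 0 = x ∧ h (Fin.last m) = e then ∑ μ : Fin m → α,
        (∏ c : Fin m, vertexWeight a b (h c.castSucc) (κ c) (h c.succ) (μ c)) *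
          f (wordOf e μ) else 0 := by
  rw [rowOp_eq_sum]
  refine Finset.sum_congr rfl fun h _ => ?_
  have hm : wordOf e κ m = e := dif_neg (lt_irrefl m)
  have h0 : ∀ μ : Fin m → α, outWord (h 0) μ (wordOf e κ) 0 = h 0 := fun _ => rfl
  have hout : ∀ μ : Fin m → α, (fun p => outWord (h 0) μ (wordOf e κ) (p + 1)) = wordOf e μ := by
    intro μ
    funext p
    simp only [outWord, wordOf]
    split_ifs <;> first | rfl | omega
  simp only [hm, exit, hout, h0, wordOf_val, and_comm (a := h 0 = x), ite_and]
  split_ifs <;> simp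

open Classical in
/-- The partition function as a sum over all labelings with the given boundary. -/
theorem rowsPF_eq_sum (a b : ℕ → α → α → R) (x : ℕ → α) (e : α) (m j k : ℕ) (κ : Fin m → α) :
    rowsPF a b x e m j k (wordOf e κ) =
      ∑ hor : Fin j → Fin (m + 1) → α, ∑ vert : Fin (j + 1) → Fin m → α,
        if vert 0 = κ ∧ (∀ c, vert (Fin.last j) c = e) ∧
          ∀ r : Fin j, hor r 0 = x (k + r) ∧ hor r (Fin.last m) = e then
          ∏ r : Fin j, ∏ c : Fin m, vertexWeight (a (k + r)) (b (k + r)) (hor r c.castSucc)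
            (vert r.castSucc c) (hor r c.succ) (vert r.succ c) else 0 := by
  induction j generalizing k κ with
  | zero =>
    have h : (∀ p, wordOf e κ p = e) ↔ ∀ c, κ c = e :=
      ⟨fun h c => by rw [← wordOf_val e κ, h], fun h p => by unfold wordOf; split_ifs <;> simp [h]⟩
    symm
    rw [Fintype.sum_unique, Finset.sum_eq_single fun _ => κ]
    · simp [rowsPF, h]
    · intro v _ hv
      rw [if_neg]
      rintro ⟨h0, -⟩
      exact hv (funext fun r => by rw [show r = 0 from Fin.ext (by omega), h0])
    · simp
  | succ j ih =>
    rw [rowsPF, rowOp_exit_eq_sum]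
    symm
    rw [sum_fin_cons]
    refine Finset.sum_congr rfl fun h _ => ?_
    have hR : ∀ hor : Fin j → Fin (m + 1) → α,
        (∑ vert : Fin (j + 2) → Fin m → α,
          if vert 0 = κ ∧ (∀ c, vert (Fin.last (j + 1)) c = e) ∧
            ∀ r : Fin (j + 1), (Fin.cons h hor : Fin (j + 1) → Fin (m + 1) → α) r 0 = x (k + r) ∧
              (Fin.cons h hor : Fin (j + 1) → Fin (m + 1) → α) r (Fin.last m) = e then
            ∏ r : Fin (j + 1), ∏ c : Fin m, vertexWeight (a (k + r)) (b (k + r))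
              ((Fin.cons h hor : Fin (j + 1) → Fin (m + 1) → α) r c.castSucc)
              (vert r.castSucc c) ((Fin.cons h hor : Fin (j + 1) → Fin (m + 1) → α) r c.succ)
              (vert r.succ c) else 0) =
        ∑ vert : Fin (j + 1) → Fin m → α,
          if (h 0 = x k ∧ h (Fin.last m) = e) ∧ (∀ c, vert (Fin.last j) c = e) ∧
            ∀ r : Fin j, hor r 0 = x (k + 1 + r) ∧ hor r (Fin.last m) = e then
            (∏ c : Fin m, vertexWeight (a k) (b k) (h c.castSucc) (κ c) (h c.succ) (vert 0 c)) *
            ∏ r : Fin j, ∏ c : Fin m, vertexWeight (a (k + 1 + r)) (b (k + 1 + r))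
              (hor r c.castSucc) (vert r.castSucc c) (hor r c.succ) (vert r.succ c) else 0 := by
      intro hor
      rw [sum_fin_cons, Finset.sum_eq_single κ]
      · refine Finset.sum_congr rfl fun vert _ => ?_
        have hlast : (Fin.cons κ vert : Fin (j + 2) → Fin m → α) (Fin.last (j + 1)) =
            vert (Fin.last j) := by rw [← Fin.succ_last, Fin.cons_succ]
        have hcast : ∀ r : Fin j, (Fin.cons κ vert : Fin (j + 2) → Fin m → α) r.succ.castSucc =
            vert r.castSucc := fun r => by rw [← Fin.succ_castSucc, Fin.cons_succ]
        have hk : ∀ r : Fin j, k + ((r : ℕ) + 1) = k + 1 + r := fun r => by ring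
        simp only [Fin.cons_zero, true_and, Fin.forall_fin_succ, Fin.cons_succ, Fin.prod_univ_succ,
          Fin.val_zero, add_zero, Fin.val_succ, hk, Fin.castSucc_zero, hlast, hcast]
        congr 1
        simp only [eq_iff_iff]
        tauto
      · intro κ' _ hne
        refine Finset.sum_eq_zero fun vert _ => if_neg ?_
        rintro ⟨h0, -⟩
        exact hne (by simpa using h0)
      · simp
    simp only [hR, ih]
    by_cases hA : h 0 = x k ∧ h (Fin.last m) = e
    · simp only [hA, and_self, true_and, if_true, Finset.mul_sum, mul_ite, mul_zero]
      symm
      refine Finset.sum_comm.trans (Finset.sum_congr rfl fun hor _ => ?_)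
      refine Finset.sum_comm.trans (Finset.sum_congr rfl fun vert _ => ?_)
      rw [Finset.sum_eq_single (vert 0)]
      · simp only [true_and]
      · intro μ _ hμ
        rw [if_neg fun h => hμ h.1.symm]
      · simp
    · simp [hA]

end sums

/-! ### The colored model and the sorting model -/

section compare
variable {n : ℕ} (w : Equiv.Perm (Fin (n + 1)))

/-- The color that enters row `k` on the left. -/
def leftLabel (k : ℕ) : Label n := if h : k < n + 1 then some ((wLong w)⁻¹ ⟨k, h⟩) else none

theorem leftLabel_eq_some_iff {k : ℕ} {i : Fin (n + 1)} :
    leftLabel w k = some i ↔ k = wLong w i := by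
  unfold leftLabel
  split_ifs with h
  · rw [Option.some_inj, Equiv.Perm.inv_eq_iff_eq, Fin.ext_iff]
  · have := (wLong w i).isLt
    simp only [false_iff]
    omega

/-- The partition function of `j` rows of the colored model, the first of them row `k`. -/
noncomputable def colorPF (m j k : ℕ) : (ℕ → Label n) → Poly n :=
  rowsPF (fun r => colorStay w (rowVar n r)) (fun r => colorCross (rowVar n r)) (leftLabel w) none
    m j k

theorem colorPF_succ (m j k : ℕ) :
    colorPF w m (j + 1) k = rowOp (colorStay w (rowVar n k)) (colorCross (rowVar n k)) m
      (exit (leftLabel w k) (colorPF w m j (k + 1))) := by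
  simp only [colorPF, rowsPF]

/-- In the word `u` the paths of some pair of colors that must not cross have already crossed. -/
def HasCrossed (u : ℕ → Label n) : Prop :=
  ∃ i j p q, NonCrossing w i j ∧ p < q ∧ u p = some j ∧ u q = some i

variable {w}

theorem HasCrossed.exch {u : ℕ → Label n} {c : ℕ} (h : HasCrossed w u)
    (hc : ∀ i j, NonCrossing w i j → ¬(u c = some j ∧ u (c + 1) = some i)) :
    HasCrossed w (exch c u) := by
  obtain ⟨i, j, p, q, hij, hpq, hp, hq⟩ := h
  refine ⟨i, j, Equiv.swap c (c + 1) p, Equiv.swap c (c + 1) q, hij, swap_lt_swap hpq ?_, ?_, ?_⟩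
  · rintro ⟨rfl, rfl⟩; exact hc i j hij ⟨hp, hq⟩
  · simp [LascouxModel.exch, hp]
  · simp [LascouxModel.exch, hq]

theorem HasCrossed.of_exch {u : ℕ → Label n} {c : ℕ} (h : HasCrossed w (LascouxModel.exch c u))
    (hc : ∀ i j, NonCrossing w i j → ¬(u c = some i ∧ u (c + 1) = some j)) :
    HasCrossed w u := by
  have h1 := h.exch (c := c) fun i j hij h1 => hc i j hij (by simpa [and_comm] using h1)
  have h2 : LascouxModel.exch c (LascouxModel.exch c u) = u := by
    funext p; simp [LascouxModel.exch]
  rwa [h2] at h1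

theorem colorCross_of_nonCrossing {i j : Fin (n + 1)} (h : NonCrossing w i j) (z : Poly n) :
    colorCross z (some j) (some i) = 0 := if_neg h.1.not_gt

/-- Colors in the wrong order never change it again, so they cannot leave in the right rows. -/
theorem step_eq_zero_of_hasCrossed {z : Poly n} {c : ℕ} {f : (ℕ → Label n) → Poly n}
    (hf : ∀ u, HasCrossed w u → f u = 0) {u : ℕ → Label n} (hu : HasCrossed w u) :
    step (colorStay w z) (colorCross z) c f u = 0 := by
  rw [step, hf u hu, mul_zero, zero_add]
  by_cases hc : ∃ i j, NonCrossing w i j ∧ u c = some j ∧ u (c + 1) = some i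
  · obtain ⟨i, j, hij, h1, h2⟩ := hc
    rw [h1, h2, colorCross_of_nonCrossing hij, zero_mul]
  · rw [hf _ (hu.exch fun i j hij h => hc ⟨i, j, hij, h⟩), mul_zero]

theorem rowLabel_some (v : Equiv.Perm (Fin (n + 1))) (i : Fin (n + 1)) :
    rowLabel v (some i) = ((v i : ℕ) : WithTop ℕ) := rfl

/-- As long as no forbidden crossing has occurred, a vertex of the colored model acts as a vertex
of the sorting model. -/
theorem step_color_eq_step_sort {z : Poly n} {c : ℕ} {f : (ℕ → Label n) → Poly n}
    {f' : (ℕ → WithTop ℕ) → Poly n} (hf : ∀ u, HasCrossed w u → f u = 0)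
    (hff' : ∀ u, ¬HasCrossed w u → f u = f' fun p => rowLabel (wLong w) (u p))
    {u : ℕ → Label n} (hu : ¬HasCrossed w u) :
    step (colorStay w z) (colorCross z) c f u =
      step (sortStay (beta n) z) (sortCross z) c f' fun p => rowLabel (wLong w) (u p) := by
  have hexch : (∀ i j, NonCrossing w i j → ¬(u c = some i ∧ u (c + 1) = some j)) →
      f (exch c u) = f' (exch c fun p => rowLabel (wLong w) (u p)) := fun h =>
    hff' _ fun h' => hu (h'.of_exch h)
  rw [step, step, hff' u hu]
  generalize ht : u c = t at hexch ⊢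
  generalize hr : u (c + 1) = r at hexch ⊢
  rcases t with _ | t
  · rw [hexch (by simp)]
    rcases r with _ | r
    · simp [colorStay, colorCross, rowLabel, sortStay, sortCross]
    · simp [colorStay, colorCross, rowLabel, sortStay, sortCross]
  rcases r with _ | r
  · simp [colorStay, colorCross, rowLabel, sortStay, sortCross]
  simp only [colorStay, colorCross, rowLabel_some, sortStay, sortCross, Nat.cast_le, Fin.val_fin_le]
  have htop : (((wLong w t : Fin (n + 1)) : ℕ) : WithTop ℕ) ≠ ⊤ := WithTop.coe_ne_top
  rcases lt_trichotomy t r with h | rfl | h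
  · by_cases hv : wLong w t < wLong w r
    · -- The colored model also admits the crossing here, but it leads to no state.
      have hcr : HasCrossed w (exch c u) :=
        ⟨t, r, c, c + 1, ⟨h, hv⟩, by omega, by simp [hr], by simp [ht]⟩
      have hN : NonCrossing w t r := ⟨h, hv⟩
      simp [h, hN, hv.le, hf _ hcr]
    · have hN : ¬NonCrossing w t r := fun h => hv h.2
      have hle : ¬wLong w t ≤ wLong w r := fun hle =>
        hv (lt_of_le_of_ne hle fun he => h.ne ((wLong w).injective he))
      rw [hexch fun i j hij h' => hN (by
        rw [Option.some_inj, Option.some_inj] at h'; rw [h'.1, h'.2]; exact hij)]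
      simp [h, hN, hle, htop]
  · simp
  · have hle : wLong w t ≤ wLong w r := by
      by_contra hv
      exact hu ⟨r, t, c, c + 1, ⟨h, not_le.1 hv⟩, by omega, ht, hr⟩
    simp [h.not_gt, hle]

/-- The two models have the same partition function: a state of the colored model never lets a pair
of `NonCrossing` colors cross, and then each of its vertices sorts the rows of destination of the
two colors. -/
theorem colorPF_eq_sortPF (m j k : ℕ) :
    (∀ u, HasCrossed w u → colorPF w m j k u = 0) ∧
      ∀ u, ¬HasCrossed w u → k + j = n + 1 →
        colorPF w m j k u = sortPF (beta n) (rowVar n) m j k fun p => rowLabel (wLong w) (u p) := by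
  induction j generalizing k with
  | zero =>
    constructor
    · rintro u ⟨i, j, p, q, -, -, hp, -⟩
      simp only [colorPF, rowsPF]
      rw [if_neg fun h => by simp [h p] at hp]
    · intro u _ _
      simp only [colorPF, sortPF, rowsPF]
      congr 1
      refine propext (forall_congr' fun p => ?_)
      cases u p with
      | none => simp [rowLabel]
      | some i => simp [rowLabel]
  | succ j ih =>
    obtain ⟨ih1, ih2⟩ := ih (k + 1)
    have h1 : ∀ u, HasCrossed w u → exit (leftLabel w k) (colorPF w m j (k + 1)) u = 0 := by
      rintro u ⟨i, l, p, q, hil, hpq, hp, hq⟩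
      unfold exit
      split_ifs with h0
      · obtain ⟨q, rfl⟩ := Nat.exists_eq_succ_of_ne_zero (show q ≠ 0 by omega)
        cases p with
        | zero =>
          -- The color `l` leaves before `i`, which should have left in an earlier row.
          have hk : k = wLong w l := (leftLabel_eq_some_iff w).1 (h0.symm.trans hp)
          refine rowsPF_eq_zero _ _ _ m (Option.some_ne_none i) j (k + 1) ?_ _ ⟨q, hq⟩
          intro k' hk' _ h
          have h3 := (leftLabel_eq_some_iff w).1 h
          have h4 : (wLong w i : ℕ) < wLong w l := hil.2
          omega
        | succ p => exact ih1 _ ⟨i, l, p, q, hil, by omega, hp, hq⟩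
      · rfl
    have h2 : k + (j + 1) = n + 1 → ∀ u, ¬HasCrossed w u →
        exit (leftLabel w k) (colorPF w m j (k + 1)) u =
          exit (k : WithTop ℕ) (sortPF (beta n) (rowVar n) m j (k + 1))
            fun p => rowLabel (wLong w) (u p) := by
      intro hk u hu
      have hiff : u 0 = leftLabel w k ↔ rowLabel (wLong w) (u 0) = (k : WithTop ℕ) := by
        cases h : u 0 with
        | none =>
          refine iff_of_false (fun h' => ?_) (WithTop.coe_ne_top (a := k)).symm
          simp only [leftLabel, dif_pos (show k < n + 1 by omega), reduceCtorEq] at h'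
        | some i =>
          rw [eq_comm, leftLabel_eq_some_iff, rowLabel, Nat.cast_inj, eq_comm]
      unfold exit
      simp only [hiff]
      split_ifs
      · refine ih2 _ ?_ (by omega)
        rintro ⟨i, l, p, q, hil, hpq, hp, hq⟩
        exact hu ⟨i, l, p + 1, q + 1, hil, by omega, hp, hq⟩
      · rfl
    rw [colorPF_succ, sortPF_succ]
    have h3 := rowOp_induction (m := m) (a := colorStay w (rowVar n k))
      (b := colorCross (rowVar n k)) (a' := sortStay (beta n) (rowVar n k))
      (b' := sortCross (rowVar n k)) (fun f f' => (∀ u, HasCrossed w u → f u = 0) ∧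
        (k + (j + 1) = n + 1 → ∀ u, ¬HasCrossed w u → f u = f' fun p => rowLabel (wLong w) (u p)))
      (fun c _ f f' hf => ⟨fun u hu => step_eq_zero_of_hasCrossed hf.1 hu,
        fun hk u hu => step_color_eq_step_sort hf.1 (hf.2 hk) hu⟩) ⟨h1, h2⟩
    exact ⟨h3.1, fun u hu hk => h3.2 hk u hu⟩

theorem not_hasCrossed_topLabel {lam : Fin (n + 1) → ℕ} (hlam : Antitone lam) :
    ¬HasCrossed w (topLabel lam) := by
  rintro ⟨i, j, p, q, hij, hpq, hp, hq⟩
  rw [topLabel_eq_some_iff hlam] at hp hq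
  have := topCol_strictMono hlam hij.1
  omega

end compare

section partition
variable {n m : ℕ}

theorem weight_eq (w : Equiv.Perm (Fin (n + 1))) (S : Labeling n m) :
    S.weight w = ∏ r : Fin (n + 1), ∏ c : Fin m,
      vertexWeight (colorStay w (rowVar n (0 + r))) (colorCross (rowVar n (0 + r)))
        (S.hor r c.castSucc) (S.vert r.castSucc c) (S.hor r c.succ) (S.vert r.succ c) := by
  refine Finset.prod_congr rfl fun r _ => Finset.prod_congr rfl fun c _ => ?_
  rw [zero_add, rowVar_val, Labeling.vertexAt, elim_vertexType]
  rfl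

theorem weight_eq_zero (w : Equiv.Perm (Fin (n + 1))) (S : Labeling n m)
    (h : ¬∀ r c, (S.vertexAt w r c).isSome) : S.weight w = 0 := by
  push Not at h
  obtain ⟨r, c, h⟩ := h
  refine Finset.prod_eq_zero (Finset.mem_univ r) (Finset.prod_eq_zero (Finset.mem_univ c) ?_)
  cases h' : S.vertexAt w r c with
  | none => rfl
  | some t => simp [h'] at h

theorem partitionFunction_eq_colorPF {lam : Fin (n + 1) → ℕ} (hlam : Antitone lam)
    (hm : n + 1 + lam 0 ≤ m) (w : Equiv.Perm (Fin (n + 1))) :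
    partitionFunction m lam w = colorPF w m (n + 1) 0 (topLabel lam) := by
  classical
  have htop : topLabel lam = wordOf none fun c : Fin m => topLabel lam c := by
    funext p
    unfold wordOf
    split_ifs with h
    · rfl
    · exact topLabel_eq_none fun i hi => h (hi ▸ topCol_lt hlam hm i)
  rw [htop, colorPF, rowsPF_eq_sum, ← Fintype.sum_prod_type', partitionFunction, states,
    Finset.sum_filter, ← (Labeling.equivProd n m).symm.sum_comp]
  refine Finset.sum_congr rfl fun S _ => ?_
  obtain ⟨hor, vert⟩ := S
  rw [weight_eq]
  have hleft : (∀ i, hor (wLong w i) 0 = some i) ↔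
      ∀ r : Fin (n + 1), hor r 0 = leftLabel w (0 + r) := by
    constructor
    · intro h r
      rw [← (wLong w).apply_symm_apply r, h, zero_add, eq_comm, leftLabel_eq_some_iff]
    · intro h i
      rw [h, zero_add, leftLabel_eq_some_iff]
  have htop' : (∀ (c : Fin m) (i : Fin (n + 1)), vert 0 c = some i ↔ (c : ℕ) = lam i.rev + i) ↔
      vert 0 = fun c : Fin m => topLabel lam c := by
    constructor
    · intro h
      funext c
      refine Option.ext fun i => ?_
      rw [h, topLabel_eq_some_iff hlam]; rfl
    · intro h c i
      rw [h, topLabel_eq_some_iff hlam]; rfl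
  by_cases hadm : ∀ r c, (Labeling.vertexAt w ⟨hor, vert⟩ r c).isSome
  · refine if_congr ?_ rfl rfl
    constructor
    · intro h
      exact ⟨htop'.1 h.top, h.bottom, fun r => ⟨hleft.1 h.left r, h.right r⟩⟩
    · rintro ⟨h1, h2, h3⟩
      exact ⟨hleft.2 fun r => (h3 r).1, htop'.2 h1, fun r => (h3 r).2, h2, hadm⟩
  · have h0 := weight_eq_zero w ⟨hor, vert⟩ hadm
    rw [weight_eq] at h0
    rw [if_neg fun h => hadm h.admissible]
    split_ifs
    · exact h0.symm
    · rfl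

theorem partitionFunction_eq_sortPF {lam : Fin (n + 1) → ℕ} (hlam : Antitone lam)
    (hm : n + 1 + lam 0 ≤ m) (w : Equiv.Perm (Fin (n + 1))) :
    partitionFunction m lam w =
      sortPF (beta n) (rowVar n) m (n + 1) 0 (topWord lam (wLong w)) := by
  rw [partitionFunction_eq_colorPF hlam hm,
    (colorPF_eq_sortPF m (n + 1) 0).2 _ (not_hasCrossed_topLabel hlam) (by omega)]
  rfl

end partition
end LascouxModel

theorem mainTheorem2 (n m : ℕ) (lam : Fin (n + 1) → ℕ) (hlam : Antitone lam)
    (hm : n + 1 + lam 0 ≤ m) (w : Equiv.Perm (Fin (n + 1))) :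
    LascouxModel.lascoux w lam = LascouxModel.partitionFunction m lam w ∧
      ∀ l : List (Fin n), LascouxModel.IsReducedWord w l →
        LascouxModel.demazureLascouxWord l (LascouxModel.zPow lam) =
          LascouxModel.lascoux w lam := by
  have h : ∀ l : List (Fin n), LascouxModel.IsReducedWord w l →
      LascouxModel.demazureLascouxWord l (LascouxModel.zPow lam) =
        LascouxModel.partitionFunction m lam w := by
    intro l hl
    obtain rfl := hl.1
    rw [LascouxModel.demazureLascouxWord_eq_sortPF hlam hm l hl,
      LascouxModel.partitionFunction_eq_sortPF hlam hm]
  have h0 := h _ (LascouxModel.exists_isReducedWord w).choose_spec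
  exact ⟨h0, fun l hl => (h l hl).trans h0.symm⟩
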